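/- **Setting.** Let $N\ge 1$ and $B>0$. Let $F$ be an atomless probability distribution with support exactly $[0,B]$, and let $D$ be any probability distribution on $[0,B]$. In rounds $t=1,2,\dots$ bidders $1,\dots,N$ have values $v_{1,t},\dots,v_{N,t}\sim F$ and there is an outside bid $d^O_t\sim D$; all these variables are independent. Given bids $b_{1,t},\dots,b_{N,t}$, bidder $i$ faces the competing bid $d_{i,t}=\max\{d^O_t,\max_{j\ne i}b_{j,t}\}$, receives the allocation $x_{i,t}=\mathbb 1\{b_{i,t}\ge d_{i,t}\}$, and has utility $g_{i,t}=x_{i,t}(v_{i,t}-d_{i,t})$. The coalition's value in round $t$ is $V_t=\sum_{i=1}^N v_{i,t}x_{i,t}$. A Legendre mirror map is a $C^1$ strictly convex function $h:(0,\infty)\to\mathbb R$ such that $h'$ is a bijection of $(0,\infty)$ onto $\mathbb R$; put $D_h(\lambda,\mu)=h(\lambda)-h(\mu)-h'(\mu)(\lambda-\mu)$. For a horizon $T$ and learning rate $\alpha=1/\sqrt T$, every bidder starts with the multiplier $\lambda_{i,1}=1$ and updates $$\lambda_{i,t+1}=\arg\min_{\lambda>0}\{\alpha\, g_{i,t}\,\lambda+D_h(\lambda,\lambda_{i,t})\}.$$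 Under *independent bidding* (I) every bidder bids $b_{i,t}=(1+1/\lambda_{i,t})v_{i,t}$ in every round. Under *coordinated bidding* (C) only a bidder $i^\star_t\in\arg\max_i v_{i,t}$ bids $(1+1/\lambda_{i,t})v_{i,t}$, and all other bidders bid $0$ (ties in the $\arg\max$ are broken by any fixed measurable rule of the values). Let $V^{C}_t$ and $V^{I}_t$ be the coalition's values in round $t$ in the two scenarios, run for horizon $T$. **Theorem.** For every Legendre mirror map $h$, the limit $L=\lim_{T\to\infty}\mathbb E\big[\frac1T\sum_{t=1}^T V^C_t\big]$ exists, and $\limsup_{T\to\infty}\mathbb E\big[\frac1T\sum_{t=1}^T V^I_t\big]\le L$. Consequently $$\liminf_{T\to\infty}\ \mathbb E\Big[\tfrac1T\sum_{t=1}^T V^C_t-\tfrac1T\sum_{t=1}^T V^I_t\Big]\ \ge\ 0 .$$ (All these expectations are of integrable random variables.) -/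

import Mathlib

open Set Filter Topology MeasureTheory ProbabilityTheory

noncomputable section

namespace AutoBid

/-! ### Mirror descent on the half-line -/

/-- A Legendre mirror map on `(0, ∞)`: a `C¹`, strictly convex function there, whose derivative is a
bijection from `(0, ∞)` onto `ℝ`. Values of `h` outside `(0, ∞)` are irrelevant. -/
structure IsLegendreMirrorMap (h : ℝ → ℝ) : Prop where
  contDiffOn : ContDiffOn ℝ 1 h (Ioi 0)
  strictConvexOn : StrictConvexOn ℝ (Ioi 0) h
  bijOn_deriv : BijOn (deriv h) (Ioi 0) univ

/-- The Bregman divergence `D_h(x, y) = h x - h y - h' y (x - y)`. -/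
def bregman (h : ℝ → ℝ) (x y : ℝ) : ℝ := h x - h y - deriv h y * (x - y)

/-- `μ` minimizes `x ↦ α g x + D_h(x, lam)` over `x > 0`. -/
def IsMirrorStep (h : ℝ → ℝ) (α g lam μ : ℝ) : Prop :=
  0 < μ ∧ IsMinOn (fun x => α * g * x + bregman h x lam) (Ioi 0) μ

/-- The mirror-descent update `argmin_{x > 0} {α g x + D_h(x, lam)}`. For a Legendre mirror map the
minimizer exists and is unique, see `existsUnique_isMirrorStep`. -/
def mirrorStep (h : ℝ → ℝ) (α g lam : ℝ) : ℝ :=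
  Classical.epsilon (IsMirrorStep h α g lam)

theorem existsUnique_isMirrorStep {h : ℝ → ℝ} (hh : IsLegendreMirrorMap h) (α g lam : ℝ) :
    ∃! μ, IsMirrorStep h α g lam μ := by
  have hsc : StrictConvexOn ℝ (Ioi 0) (fun x => α * g * x + bregman h x lam) := by
    have h1 : ConvexOn ℝ (Ioi (0 : ℝ))
        (fun x => (α * g - deriv h lam) * x + (deriv h lam * lam - h lam)) := by
      refine ⟨convex_Ioi 0, fun x _ y _ a b _ _ hab => le_of_eq ?_⟩
      simp only [smul_eq_mul]
      linear_combination (deriv h lam * lam - h lam) * (-hab)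
    have h2 := hh.strictConvexOn.add_convexOn h1
    have e : (h + fun x => (α * g - deriv h lam) * x + (deriv h lam * lam - h lam))
        = fun x => α * g * x + bregman h x lam := by
      funext x
      simp only [Pi.add_apply, bregman]
      ring
    rwa [e] at h2
  obtain ⟨μ, hμ, hd⟩ := hh.bijOn_deriv.surjOn (mem_univ (deriv h lam - α * g))
  have hμ' : (0 : ℝ) < μ := hμ
  have hdiff : HasDerivAt h (deriv h μ) μ :=
    ((hh.contDiffOn.differentiableOn (by norm_num)).differentiableAt
      (Ioi_mem_nhds hμ')).hasDerivAt
  have hmin : IsMinOn (fun x => α * g * x + bregman h x lam) (Ioi 0) μ := by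
    intro x hx
    have hslope : h μ + deriv h μ * (x - μ) ≤ h x := by
      rcases lt_trichotomy x μ with hlt | heq | hgt
      · have := hh.strictConvexOn.convexOn.slope_le_of_hasDerivAt hx hμ hlt hdiff
        rw [slope_def_field, div_le_iff₀ (by linarith)] at this
        linarith
      · subst heq; simp
      · have := hh.strictConvexOn.convexOn.le_slope_of_hasDerivAt hμ hx hgt hdiff
        rw [slope_def_field, le_div_iff₀ (by linarith)] at this
        linarith
    change α * g * μ + bregman h μ lam ≤ α * g * x + bregman h x lam
    simp only [bregman]
    rw [hd] at hslope
    linarith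
  refine ⟨μ, ⟨hμ', hmin⟩, fun ν hν => ?_⟩
  exact hsc.eq_of_isMinOn hν.2 hmin hν.1 hμ

/-! ### One second-price auction with an outside bid -/

variable {N : ℕ}

/-- The bid that bidder `i` competes against: the maximum of the outside bid `dO` and of the bids of
all other bidders. -/
def competingBid (dO : ℝ) (b : Fin N → ℝ) (i : Fin N) : ℝ :=
  (Finset.univ.erase i).fold max dO b

/-- The allocation: `1` if bidder `i` bids at least the competing bid, `0` otherwise. -/
def alloc (dO : ℝ) (b : Fin N → ℝ) (i : Fin N) : ℝ :=
  if competingBid dO b i ≤ b i then 1 else 0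

def payment (dO : ℝ) (b : Fin N → ℝ) (i : Fin N) : ℝ :=
  alloc dO b i * competingBid dO b i

def utility (v : Fin N → ℝ) (dO : ℝ) (b : Fin N → ℝ) (i : Fin N) : ℝ :=
  v i * alloc dO b i - payment dO b i

/-- The total value obtained by the coalition in one auction. -/
def totalValue (v : Fin N → ℝ) (dO : ℝ) (b : Fin N → ℝ) : ℝ :=
  ∑ i, v i * alloc dO b i

/-! ### Bidding scenarios -/

/-- A bidding scenario turns the values and multipliers of a round into the bids of that round. -/
abbrev Scenario (N : ℕ) : Type := (Fin N → ℝ) → (Fin N → ℝ) → Fin N → ℝ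

/-- Independent bidding: every bidder bids `(1 + 1/λᵢ) vᵢ`. -/
def independent : Scenario N := fun v lam i => (1 + 1 / lam i) * v i

/-- A measurable rule choosing, from a vector of values, a bidder of highest value. -/
structure IsArgmaxRule (sel : (Fin N → ℝ) → Fin N) : Prop where
  measurable : Measurable sel
  le : ∀ (v : Fin N → ℝ) (j : Fin N), v j ≤ v (sel v)

/-- Coordinated bidding: only the chosen bidder of highest value bids `(1 + 1/λᵢ) vᵢ`, all other
bidders bid `0`. -/
def coordinated (sel : (Fin N → ℝ) → Fin N) : Scenario N :=
  fun v lam i => if i = sel v then (1 + 1 / lam i) * v i else 0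

/-! ### The dynamics

Rounds are numbered from `0`: `v t` and `dO t` are the values and the outside bid of the round with
number `t`, and `multipliers … t` are the multipliers used in that round. -/

def multipliers (h : ℝ → ℝ) (α : ℝ) (bid : Scenario N) (v : ℕ → Fin N → ℝ) (dO : ℕ → ℝ) :
    ℕ → Fin N → ℝ
  | 0 => fun _ => 1
  | t + 1 => fun i =>
      mirrorStep h α
        (utility (v t) (dO t) (bid (v t) (multipliers h α bid v dO t)) i)
        (multipliers h α bid v dO t i)

/-- The time-averaged total coalition value over `T` rounds, when all bidders run mirror descent with
mirror map `h` and learning rate `1/√T`. -/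
def avgValue (h : ℝ → ℝ) (bid : Scenario N) (T : ℕ) (v : ℕ → Fin N → ℝ) (dO : ℕ → ℝ) : ℝ :=
  (1 / (T : ℝ)) * ∑ t ∈ Finset.range T,
    totalValue (v t) (dO t) (bid (v t) (multipliers h (1 / √(T : ℝ)) bid v dO t))

/-- The time-averaged total coalition value as a random variable, when the values `v t` and the
outside bids `dO t` are random. -/
def avgValueRV {Ω : Type*} (h : ℝ → ℝ) (bid : Scenario N) (v : ℕ → Ω → Fin N → ℝ)
    (dO : ℕ → Ω → ℝ) (T : ℕ) (ω : Ω) : ℝ :=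
  avgValue h bid T (fun t => v t ω) (fun t => dO t ω)

end AutoBid

end

noncomputable section

namespace AutoBid

/-! ### The dual variable of mirror descent -/

/-- The inverse of `deriv h` on `(0, ∞)`, which sends a dual variable to its multiplier. -/
def dualInv (h : ℝ → ℝ) (θ : ℝ) : ℝ := Function.invFunOn (deriv h) (Ioi 0) θ

section Mirror

variable {h : ℝ → ℝ}

theorem IsLegendreMirrorMap.differentiableAt (hh : IsLegendreMirrorMap h) {x : ℝ} (hx : 0 < x) :
    DifferentiableAt ℝ h x :=
  (hh.contDiffOn.differentiableOn (by norm_num)).differentiableAt (Ioi_mem_nhds hx)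

theorem IsLegendreMirrorMap.strictMonoOn_deriv (hh : IsLegendreMirrorMap h) :
    StrictMonoOn (deriv h) (Ioi 0) :=
  hh.strictConvexOn.strictMonoOn_deriv fun _ hx => hh.differentiableAt hx

theorem dualInv_pos (hh : IsLegendreMirrorMap h) (θ : ℝ) : 0 < dualInv h θ :=
  Function.invFunOn_mem (hh.bijOn_deriv.surjOn (mem_univ θ))

theorem deriv_dualInv (hh : IsLegendreMirrorMap h) (θ : ℝ) : deriv h (dualInv h θ) = θ :=
  Function.invFunOn_eq (hh.bijOn_deriv.surjOn (mem_univ θ))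

theorem dualInv_deriv (hh : IsLegendreMirrorMap h) {x : ℝ} (hx : 0 < x) :
    dualInv h (deriv h x) = x :=
  hh.bijOn_deriv.injOn (dualInv_pos hh _) hx (deriv_dualInv hh _)

theorem strictMono_dualInv (hh : IsLegendreMirrorMap h) : StrictMono (dualInv h) := by
  intro a b hab
  rw [← deriv_dualInv hh a, ← deriv_dualInv hh b] at hab
  exact (hh.strictMonoOn_deriv.lt_iff_lt (dualInv_pos hh a) (dualInv_pos hh b)).1 hab

theorem continuous_dualInv (hh : IsLegendreMirrorMap h) : Continuous (dualInv h) := by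
  let e : ℝ → Ioi (0 : ℝ) := fun θ => ⟨dualInv h θ, dualInv_pos hh θ⟩
  have hm : Monotone e := fun a b hab => (strictMono_dualInv hh).monotone hab
  have hs : Function.Surjective e := fun x =>
    ⟨deriv h x, Subtype.ext (dualInv_deriv hh x.2)⟩
  exact continuous_subtype_val.comp (hm.continuous_of_surjective hs)

theorem mirrorStep_spec (hh : IsLegendreMirrorMap h) (α g lam : ℝ) :
    IsMirrorStep h α g lam (mirrorStep h α g lam) :=
  Classical.epsilon_spec (existsUnique_isMirrorStep hh α g lam).exists

theorem deriv_mirrorStep (hh : IsLegendreMirrorMap h) (α g lam : ℝ) :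
    deriv h (mirrorStep h α g lam) = deriv h lam - α * g := by
  obtain ⟨hpos, hmin⟩ := mirrorStep_spec hh α g lam
  set μ := mirrorStep h α g lam
  have hd : HasDerivAt (fun x => α * g * x + bregman h x lam)
      (α * g * 1 + (deriv h μ - deriv h lam * 1)) μ := by
    unfold bregman
    exact ((hasDerivAt_id μ).const_mul (α * g)).add
      (((hh.differentiableAt hpos).hasDerivAt.sub_const (h lam)).sub
        (((hasDerivAt_id μ).sub_const lam).const_mul (deriv h lam)))
  have := (hmin.isLocalMin (Ioi_mem_nhds hpos)).hasDerivAt_eq_zero hd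
  linarith

theorem mirrorStep_eq_dualInv (hh : IsLegendreMirrorMap h) (α g lam : ℝ) :
    mirrorStep h α g lam = dualInv h (deriv h lam - α * g) := by
  rw [← deriv_mirrorStep hh, dualInv_deriv hh (mirrorStep_spec hh α g lam).1]

end Mirror

/-! ### Deterministic estimates along the dual trajectory -/

/-- The truncation `min (dualInv h ·) K` is uniformly continuous on the whole line. -/
theorem exists_delta_min_dualInv {h : ℝ → ℝ} (hh : IsLegendreMirrorMap h) {K η : ℝ} (hK : 0 < K)
    (hη : 0 < η) : ∃ δ > 0, ∀ x y : ℝ, |y - x| ≤ δ →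
      |min (dualInv h y) K - min (dualInv h x) K| ≤ η := by
  set η' := min (η / 2) K
  have hη' : 0 < η' := lt_min (half_pos hη) hK
  set a := deriv h η'
  set b := deriv h K
  have hab : a ≤ b := hh.strictMonoOn_deriv.monotoneOn hη' hK (min_le_right _ _)
  have ha : dualInv h a = η' := dualInv_deriv hh hη'
  have hb : dualInv h b = K := dualInv_deriv hh hK
  have hmono := (strictMono_dualInv hh).monotone
  have huc : UniformContinuous fun x : ℝ => dualInv h (projIcc a b hab x) := by
    have h1 : UniformContinuous fun x : Icc a b => dualInv h x :=
      CompactSpace.uniformContinuous_of_continuous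
        ((continuous_dualInv hh).comp continuous_subtype_val)
    exact h1.comp (LipschitzWith.projIcc hab).uniformContinuous
  obtain ⟨δ, hδ, hδ'⟩ := Metric.uniformContinuous_iff.1 huc (η / 2) (half_pos hη)
  have hclamp : ∀ x, dualInv h (projIcc a b hab x) = max η' (min (dualInv h x) K) := by
    intro x
    rw [coe_projIcc, hmono.map_max, hmono.map_min, ha, hb, min_comm]
  refine ⟨δ / 2, by positivity, fun x y hxy => ?_⟩
  have := hδ' (a := y) (b := x) (by rw [Real.dist_eq]; linarith)
  rw [Real.dist_eq, hclamp, hclamp, abs_lt] at this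
  have hx := dualInv_pos hh x
  have hy := dualInv_pos hh y
  have h1 : η' ≤ η / 2 := min_le_left _ _
  have hx' : 0 < min (dualInv h x) K := lt_min hx hK
  have hy' : 0 < min (dualInv h y) K := lt_min hy hK
  rw [abs_le]
  constructor <;>
  rcases max_cases η' (min (dualInv h x) K) with ⟨e1, e2⟩ | ⟨e1, e2⟩ <;>
  rcases max_cases η' (min (dualInv h y) K) with ⟨e3, e4⟩ | ⟨e3, e4⟩ <;>
  rw [e1, e3] at this <;> linarith [this.1, this.2]

/-- The truncated multipliers have asymptotically nonpositive average correlation with bounded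
gradients. -/
theorem sum_min_dualInv_mul_le {h : ℝ → ℝ} (hh : IsLegendreMirrorMap h) {B K η : ℝ} (hB : 0 < B)
    (hK : 0 < K) (hη : 0 < η) (θ₀ : ℝ) : ∀ᶠ T : ℕ in atTop, ∀ θ g : ℕ → ℝ, θ 0 = θ₀ →
      (∀ t, θ (t + 1) = θ t - 1 / √(T : ℝ) * g t) → (∀ t, |g t| ≤ B) →
      ∑ t ∈ Finset.range T, min (dualInv h (θ t)) K * g t ≤ η * T := by
  set ε := η / (3 * B) with hε
  have hεpos : 0 < ε := by positivity
  have hεB : ε * B = η / 3 := by rw [hε]; field_simp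
  obtain ⟨δ, hδ, hδ'⟩ := exists_delta_min_dualInv hh hK hεpos
  set q : ℝ → ℝ := fun θ => min (dualInv h θ) K
  have hqc : Continuous q := (continuous_dualInv hh).min continuous_const
  have hqi : ∀ x y, IntervalIntegrable q volume x y := fun x y => hqc.intervalIntegrable x y
  have hqpos : ∀ x, 0 < q x := fun x => lt_min (dualInv_pos hh x) hK
  set a := deriv h ε
  have hqa : ∀ x ≤ a, q x ≤ ε := fun x hx => (min_le_left _ _).trans <| by
    have := (strictMono_dualInv hh).monotone hx
    rwa [dualInv_deriv hh hεpos] at this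
  set H : ℝ → ℝ := fun x => ∫ s in a..x, q s
  have hHlow : ∀ x, -(ε * |x - a|) ≤ H x := by
    intro x
    rcases le_total a x with hx | hx
    · have : 0 ≤ H x := intervalIntegral.integral_nonneg hx fun u _ => (hqpos u).le
      have : 0 ≤ ε * |x - a| := by positivity
      linarith
    · have := intervalIntegral.norm_integral_le_of_norm_le_const (a := a) (b := x) (f := q) (C := ε)
        (fun s hs => by
          rw [uIoc_of_ge hx] at hs
          rw [Real.norm_eq_abs, abs_of_pos (hqpos s)]
          exact hqa s hs.2)
      exact (abs_le.1 this).1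
  have hHstep : ∀ x y, |y - x| ≤ δ → H y - H x ≤ q x * (y - x) + ε * |y - x| := by
    intro x y hxy
    have h1 : H y - H x = ∫ s in x..y, q s := by
      have := intervalIntegral.integral_add_adjacent_intervals (hqi a x) (hqi x y)
      simp only [H]; linarith
    have h2 : ∫ s in x..y, (q s - q x) = (∫ s in x..y, q s) - (y - x) * q x := by
      rw [intervalIntegral.integral_sub (hqi x y) (by simp), intervalIntegral.integral_const,
        smul_eq_mul]
    have h3 := intervalIntegral.norm_integral_le_of_norm_le_const (a := x) (b := y)
      (f := fun s => q s - q x) (C := ε) (fun s hs => by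
        refine hδ' x s (le_trans ?_ hxy)
        rcases le_total x y with hle | hle
        · rw [uIoc_of_le hle] at hs
          rw [abs_of_nonneg (by linarith [hs.1]), abs_of_nonneg (by linarith)]
          linarith [hs.2]
        · rw [uIoc_of_ge hle] at hs
          rw [abs_of_nonpos (by linarith [hs.2]), abs_of_nonpos (by linarith)]
          linarith [hs.1])
    rw [h2] at h3
    have := (abs_le.1 h3).2
    rw [h1]; linarith
  set C := H θ₀ + ε * |θ₀ - a|
  have hsq : Tendsto (fun T : ℕ => √(T : ℝ)) atTop atTop :=
    Real.tendsto_sqrt_atTop.comp tendsto_natCast_atTop_atTop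
  filter_upwards [hsq.eventually_ge_atTop (B / δ), hsq.eventually_ge_atTop (3 * C / η),
    eventually_gt_atTop 0] with T hT1 hT2 hT0 θ g hθ0 hθ hg
  have hTpos : (0 : ℝ) < T := by exact_mod_cast hT0
  set r := √(T : ℝ)
  have hrpos : 0 < r := Real.sqrt_pos.2 hTpos
  have hrr : r * r = T := Real.mul_self_sqrt hTpos.le
  have hdiff : ∀ t, |θ (t + 1) - θ t| ≤ B / r := by
    intro t
    rw [hθ t, show θ t - 1 / r * g t - θ t = -(g t / r) by ring, abs_neg, abs_div,
      abs_of_pos hrpos]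
    exact div_le_div_of_nonneg_right (hg t) hrpos.le
  have hBr : B / r ≤ δ := by
    rw [div_le_iff₀ hδ] at hT1
    rw [div_le_iff₀ hrpos]; linarith
  have hstep : ∀ t, q (θ t) * g t ≤ r * (H (θ t) - H (θ (t + 1))) + ε * B := by
    intro t
    have h1 := hHstep (θ t) (θ (t + 1)) ((hdiff t).trans hBr)
    have h2 : ε * |θ (t + 1) - θ t| ≤ ε * (B / r) := by gcongr; exact hdiff t
    have h3 : r * (H (θ (t + 1)) - H (θ t)) ≤
        r * (q (θ t) * (θ (t + 1) - θ t) + ε * (B / r)) :=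
      mul_le_mul_of_nonneg_left (by linarith) hrpos.le
    have h4 : r * (q (θ t) * (θ (t + 1) - θ t) + ε * (B / r)) = -(q (θ t) * g t) + ε * B := by
      rw [hθ t]; field_simp; ring
    linarith
  have hdist : ∀ t : ℕ, |θ t - a| ≤ |θ₀ - a| + t * (B / r) := by
    intro t
    induction t with
    | zero => simp [hθ0]
    | succ t ih =>
      have := abs_add_le (θ (t + 1) - θ t) (θ t - a)
      rw [sub_add_sub_cancel] at this
      push_cast
      linarith [hdiff t]
  have hsum : ∑ t ∈ Finset.range T, q (θ t) * g t ≤ r * (H (θ 0) - H (θ T)) + T * (ε * B) := by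
    refine (Finset.sum_le_sum fun t _ => hstep t).trans ?_
    rw [Finset.sum_add_distrib, ← Finset.mul_sum, Finset.sum_range_sub']
    simp
  have hfin : r * (H (θ 0) - H (θ T)) ≤ r * C + T * (ε * B) := by
    have h1 := hHlow (θ T)
    have h2 : ε * |θ T - a| ≤ ε * (|θ₀ - a| + T * (B / r)) := by gcongr; exact hdist T
    have h3 : r * (H (θ 0) - H (θ T)) ≤ r * (C + ε * (T * (B / r))) :=
      mul_le_mul_of_nonneg_left (by rw [hθ0]; simp only [C]; linarith) hrpos.le
    have h4 : r * (C + ε * (T * (B / r))) = r * C + T * (ε * B) := by field_simp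
    linarith
  have hC : r * C ≤ η / 3 * T := by
    rw [div_le_iff₀ hη] at hT2
    have := mul_le_mul_of_nonneg_left hT2 hrpos.le
    rw [← mul_assoc r r, hrr] at this
    linarith
  have : (T : ℝ) * (ε * B) = η / 3 * T := by rw [hεB]; ring
  change ∑ t ∈ Finset.range T, q (θ t) * g t ≤ η * T
  linarith

/-- If the gradients are at least `-B / λ`, then any sequence that dominates them and is bounded
below has asymptotically nonnegative average. -/
theorem neg_mul_le_sum_of_le {h : ℝ → ℝ} (hh : IsLegendreMirrorMap h) {B ε : ℝ} (hB : 0 < B)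
    (hε : 0 < ε) (θ₀ : ℝ) : ∀ᶠ T : ℕ in atTop, ∀ θ g g' : ℕ → ℝ, θ 0 = θ₀ →
      (∀ t, θ (t + 1) = θ t - 1 / √(T : ℝ) * g t) → (∀ t, -(B / dualInv h (θ t)) ≤ g t) →
      (∀ t, g t ≤ g' t) → (∀ t, -B ≤ g' t) →
      -(ε * T) ≤ ∑ t ∈ Finset.range T, g' t := by
  set M := B / (ε / 2)
  have hM : 0 < M := by positivity
  set c := deriv h M + B
  have hc : ∀ x, c - B ≤ x → B / dualInv h x ≤ ε / 2 := by
    intro x hx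
    have h1 := (strictMono_dualInv hh).monotone hx
    rw [show c - B = deriv h M by simp [c], dualInv_deriv hh hM] at h1
    rw [div_le_iff₀ (dualInv_pos hh x)]
    calc B = ε / 2 * M := by simp only [M]; field_simp
      _ ≤ _ := by gcongr
  have hsq : Tendsto (fun T : ℕ => √(T : ℝ)) atTop atTop :=
    Real.tendsto_sqrt_atTop.comp tendsto_natCast_atTop_atTop
  filter_upwards [hsq.eventually_ge_atTop ((c - min θ₀ c) / (ε / 2)),
    hsq.eventually_ge_atTop 1, eventually_gt_atTop 0] with T hT1 hT2 hT0 θ g g' hθ0 hθ hg hgg' hg'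
  have hTpos : (0 : ℝ) < T := by exact_mod_cast hT0
  set r := √(T : ℝ)
  have hrpos : 0 < r := Real.sqrt_pos.2 hTpos
  have hrr : r * r = T := Real.mul_self_sqrt hTpos.le
  have hstep : ∀ t, r * (min (θ t) c - min (θ (t + 1)) c) - ε / 2 ≤ g' t := by
    intro t
    have hinc : r * (θ t - θ (t + 1)) = g t := by rw [hθ t]; field_simp; ring
    rcases lt_or_ge (θ (t + 1)) c with h1 | h1
    · rw [min_eq_left h1.le]
      have : r * (min (θ t) c - θ (t + 1)) ≤ r * (θ t - θ (t + 1)) :=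
        mul_le_mul_of_nonneg_left (by linarith [min_le_left (θ t) c]) hrpos.le
      linarith [hgg' t]
    · rw [min_eq_right h1]
      rcases lt_or_ge (θ t) (c - B) with h2 | h2
      · have : r * (min (θ t) c - c) ≤ 1 * (min (θ t) c - c) :=
          mul_le_mul_of_nonpos_right hT2 (by linarith [min_le_right (θ t) c])
        linarith [hg' t, min_le_left (θ t) c]
      · have : r * (min (θ t) c - c) ≤ 0 :=
          mul_nonpos_of_nonneg_of_nonpos hrpos.le (by linarith [min_le_right (θ t) c])
        linarith [hc _ h2, hg t, hgg' t]
  have hsum : r * (min (θ 0) c - min (θ T) c) - T * (ε / 2) ≤ ∑ t ∈ Finset.range T, g' t := by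
    refine le_trans (le_of_eq ?_) (Finset.sum_le_sum fun t _ => hstep t)
    rw [Finset.sum_sub_distrib, ← Finset.mul_sum, Finset.sum_range_sub']
    simp
  have h1 : r * (min θ₀ c - c) ≤ r * (min (θ 0) c - min (θ T) c) :=
    mul_le_mul_of_nonneg_left (by rw [hθ0]; linarith [min_le_right (θ T) c]) hrpos.le
  have h2 : r * (c - min θ₀ c) ≤ ε / 2 * T := by
    rw [div_le_iff₀ (by positivity)] at hT1
    have := mul_le_mul_of_nonneg_left hT1 hrpos.le
    rw [← mul_assoc r r, hrr] at this
    linarith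
  linarith


/-! ### One round of the auction -/

section Auction

variable {N : ℕ} {v b lam : Fin N → ℝ} {dO : ℝ}

/-- Bidder `i` wins the auction. -/
def Wins (dO : ℝ) (b : Fin N → ℝ) (i : Fin N) : Prop := competingBid dO b i ≤ b i

theorem competingBid_le_iff {i : Fin N} {c : ℝ} :
    competingBid dO b i ≤ c ↔ dO ≤ c ∧ ∀ j, j ≠ i → b j ≤ c := by
  simp [competingBid, Finset.fold_max_le]

theorem le_competingBid (dO : ℝ) (b : Fin N → ℝ) (i : Fin N) : dO ≤ competingBid dO b i :=
  (competingBid_le_iff.1 le_rfl).1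

theorem bid_le_competingBid (dO : ℝ) (b : Fin N → ℝ) {i j : Fin N} (hij : j ≠ i) :
    b j ≤ competingBid dO b i :=
  (competingBid_le_iff.1 le_rfl).2 j hij

theorem alloc_of_wins {i : Fin N} (hi : Wins dO b i) : alloc dO b i = 1 := if_pos hi

theorem alloc_of_not_wins {i : Fin N} (hi : ¬ Wins dO b i) : alloc dO b i = 0 := if_neg hi

theorem alloc_nonneg (dO : ℝ) (b : Fin N → ℝ) (i : Fin N) : 0 ≤ alloc dO b i := by
  unfold alloc; split_ifs <;> norm_num

theorem alloc_le_one (dO : ℝ) (b : Fin N → ℝ) (i : Fin N) : alloc dO b i ≤ 1 := by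
  unfold alloc; split_ifs <;> norm_num

theorem utility_eq (v : Fin N → ℝ) (dO : ℝ) (b : Fin N → ℝ) (i : Fin N) :
    utility v dO b i = alloc dO b i * (v i - competingBid dO b i) := by
  unfold utility payment; ring

theorem utility_le (v : Fin N → ℝ) (dO : ℝ) (b : Fin N → ℝ) (i : Fin N) :
    utility v dO b i ≤ alloc dO b i * (v i - dO) := by
  rw [utility_eq]
  exact mul_le_mul_of_nonneg_left (by linarith [le_competingBid dO b i]) (alloc_nonneg _ _ _)

theorem neg_le_alloc_mul {B : ℝ} {i : Fin N} (hv : 0 ≤ v i) (hB : 0 ≤ B) (hd : dO ≤ B) :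
    -B ≤ alloc dO b i * (v i - dO) := by
  by_cases hi : Wins dO b i
  · rw [alloc_of_wins hi]; linarith
  · rw [alloc_of_not_wins hi]; linarith

theorem neg_div_le_utility {B : ℝ} {i : Fin N} (hB : v i ≤ B) (hv : 0 ≤ v i)
    (hlam : 0 < lam i) (hb : b i ≤ (1 + 1 / lam i) * v i) :
    -(B / lam i) ≤ utility v dO b i := by
  rw [utility_eq]
  have h1 : v i / lam i ≤ B / lam i := by gcongr
  by_cases hi : Wins dO b i
  · rw [alloc_of_wins hi]
    have h2 : (1 + 1 / lam i) * v i = v i + v i / lam i := by ring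
    have : competingBid dO b i ≤ b i := hi
    linarith
  · rw [alloc_of_not_wins hi]
    have : 0 ≤ v i / lam i := by positivity
    linarith

theorem totalValue_nonneg (hv : ∀ i, 0 ≤ v i) : 0 ≤ totalValue v dO b :=
  Finset.sum_nonneg fun i _ => mul_nonneg (hv i) (alloc_nonneg _ _ _)

theorem totalValue_le {B : ℝ} (hv : ∀ i, 0 ≤ v i) (hB : ∀ i, v i ≤ B) :
    totalValue v dO b ≤ N * B := by
  refine (Finset.sum_le_sum (g := fun _ => B) fun i _ => ?_).trans (by simp)
  exact (mul_le_of_le_one_right (hv i) (alloc_le_one _ _ _)).trans (hB i)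

/-- The Lagrangian of one round, with multiplier `l` for the constraint on the utility, when the
only bidder is `s`. -/
def lagrangian (l : ℝ) (v : Fin N → ℝ) (dO : ℝ) (s : Fin N) : ℝ := max 0 (v s + l * (v s - dO))

theorem lagrangian_nonneg (l : ℝ) (v : Fin N → ℝ) (dO : ℝ) (s : Fin N) :
    0 ≤ lagrangian l v dO s := le_max_left _ _

theorem totalValue_add_le {s : Fin N} {l : ℝ} (hl : 0 ≤ l) (hs : ∀ j, v j ≤ v s)
    (hw : ∀ i j, i ≠ j → ¬ (Wins dO b i ∧ Wins dO b j)) :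
    totalValue v dO b + l * ∑ i, alloc dO b i * (v i - dO) ≤ lagrangian l v dO s := by
  rw [totalValue, Finset.mul_sum, ← Finset.sum_add_distrib]
  by_cases hex : ∃ i, Wins dO b i
  · obtain ⟨i, hi⟩ := hex
    rw [Finset.sum_eq_single i]
    · rw [alloc_of_wins hi]
      refine le_trans ?_ (le_max_right _ _)
      have := hs i
      have := mul_le_mul_of_nonneg_left this hl
      linarith
    · intro j _ hji
      rw [alloc_of_not_wins fun hj => hw j i hji ⟨hj, hi⟩]; ring
    · simp
  · push Not at hex
    rw [Finset.sum_eq_zero fun i _ => by rw [alloc_of_not_wins (hex i)]; ring]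
    exact lagrangian_nonneg _ _ _ _

theorem independent_eq_of_wins {i j : Fin N} (hij : i ≠ j) (hi : Wins dO (independent v lam) i)
    (hj : Wins dO (independent v lam) j) :
    (1 + 1 / lam i) * v i = (1 + 1 / lam j) * v j :=
  le_antisymm ((bid_le_competingBid dO (independent v lam) hij).trans hj)
    ((bid_le_competingBid dO (independent v lam) hij.symm).trans hi)

section Coordinated

variable {sel : (Fin N → ℝ) → Fin N}

theorem coordinated_wins_iff (hv : ∀ i, 0 < v i) (hlam : ∀ i, 0 < lam i)
    {i : Fin N} : Wins dO (coordinated sel v lam) i ↔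
      i = sel v ∧ dO ≤ (1 + 1 / lam i) * v i := by
  have hpos : ∀ i, 0 < (1 + 1 / lam i) * v i := fun i => by
    have := hlam i; have := hv i; positivity
  unfold Wins
  rw [competingBid_le_iff]
  by_cases hi : i = sel v
  · have : coordinated sel v lam i = (1 + 1 / lam i) * v i := if_pos hi
    rw [this]
    refine ⟨fun h => ⟨hi, h.1⟩, fun h => ⟨h.2, fun j hj => ?_⟩⟩
    rw [coordinated, if_neg fun e => hj (e.trans hi.symm)]
    exact (hpos i).le
  · have : coordinated sel v lam i = 0 := if_neg hi
    rw [this]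
    refine ⟨fun h => absurd (h.2 (sel v) (Ne.symm hi)) ?_, fun h => absurd h.1 hi⟩
    rw [coordinated, if_pos rfl]
    exact not_le.2 (hpos _)

theorem competingBid_coordinated (hd : 0 ≤ dO) :
    competingBid dO (coordinated sel v lam) (sel v) = dO :=
  le_antisymm (competingBid_le_iff.2 ⟨le_rfl, fun j hj => by rwa [coordinated, if_neg hj]⟩)
    (le_competingBid _ _ _)

theorem utility_coordinated (hv : ∀ i, 0 < v i) (hlam : ∀ i, 0 < lam i) (hd : 0 ≤ dO)
    (i : Fin N) : utility v dO (coordinated sel v lam) i =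
      alloc dO (coordinated sel v lam) i * (v i - dO) := by
  rw [utility_eq]
  by_cases hi : Wins dO (coordinated sel v lam) i
  · rw [((coordinated_wins_iff hv hlam).1 hi).1, competingBid_coordinated hd]
  · simp [alloc_of_not_wins hi]

theorem abs_utility_coordinated_le {B : ℝ} (hv : ∀ i, 0 < v i) (hvB : ∀ i, v i ≤ B)
    (hlam : ∀ i, 0 < lam i) (hd : 0 ≤ dO) (hdB : dO ≤ B) (i : Fin N) :
    |utility v dO (coordinated sel v lam) i| ≤ B := by
  rw [utility_coordinated hv hlam hd, abs_mul, abs_of_nonneg (alloc_nonneg _ _ _)]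
  refine (mul_le_of_le_one_left (abs_nonneg _) (alloc_le_one _ _ _)).trans ?_
  rw [abs_le]
  constructor <;> linarith [hv i, hvB i]

/-- The loss caused by truncating a multiplier at `K`. -/
def truncLoss (K x d : ℝ) : ℝ := if x < d ∧ K * (d - x) ≤ x then x else 0

theorem truncLoss_nonneg {K x d : ℝ} (hx : 0 ≤ x) : 0 ≤ truncLoss K x d := by
  unfold truncLoss; split_ifs <;> simp [hx]

theorem truncLoss_le {K x d : ℝ} (hx : 0 ≤ x) : truncLoss K x d ≤ x := by
  unfold truncLoss; split_ifs <;> simp [hx]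

theorem lagrangian_le_value_coordinated {K : ℝ} (hv : ∀ i, 0 < v i) (hlam : ∀ i, 0 < lam i)
    (hd : 0 ≤ dO) (hK : 0 < K) (i : Fin N) :
    (if sel v = i then lagrangian (min (lam i) K) v dO i else 0)
        - (if sel v = i then truncLoss K (v i) dO else 0)
        - min (lam i) K * utility v dO (coordinated sel v lam) i
      ≤ v i * alloc dO (coordinated sel v lam) i := by
  rw [utility_coordinated hv hlam hd]
  by_cases hi : sel v = i
  swap
  · rw [alloc_of_not_wins fun h => hi ((coordinated_wins_iff hv hlam).1 h).1.symm]
    simp [hi]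
  rw [if_pos hi, if_pos hi]
  have hvi := hv i
  have hl := hlam i
  have hq : 0 < min (lam i) K := lt_min hl hK
  have e : lam i * ((1 + 1 / lam i) * v i) = lam i * v i + v i := by field_simp
  have hloss := truncLoss_nonneg (K := K) (d := dO) hvi.le
  by_cases hw : Wins dO (coordinated sel v lam) i
  · rw [alloc_of_wins hw]
    have h1 := ((coordinated_wins_iff hv hlam).1 hw).2
    have h2 : lam i * (dO - v i) ≤ v i := by
      have := mul_le_mul_of_nonneg_left h1 hl.le
      rw [e] at this; linarith
    have h3 : 0 ≤ v i + min (lam i) K * (v i - dO) := by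
      rcases le_total dO (v i) with h | h
      · have := mul_nonneg hq.le (sub_nonneg.2 h); linarith
      · have := mul_le_mul_of_nonneg_right (min_le_left (lam i) K) (sub_nonneg.2 h)
        linarith
    rw [lagrangian, max_eq_right h3]
    linarith
  · rw [alloc_of_not_wins hw]
    have h1 : (1 + 1 / lam i) * v i < dO := by
      by_contra hcon
      exact hw ((coordinated_wins_iff hv hlam).2 ⟨hi.symm, not_lt.1 hcon⟩)
    have h2 : v i < lam i * (dO - v i) := by
      have := mul_lt_mul_of_pos_left h1 hl
      rw [e] at this; linarith
    have h3 : v i < dO := by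
      have : 0 < 1 / lam i * v i := by positivity
      linarith
    have hlag : lagrangian (min (lam i) K) v dO i ≤ truncLoss K (v i) dO := by
      refine max_le hloss ?_
      rcases le_total (lam i) K with h | h
      · rw [min_eq_left h]; linarith
      · rw [min_eq_right h, truncLoss]
        split_ifs with hc
        · have := mul_pos hK (sub_pos.2 h3); linarith
        · have : v i < K * (dO - v i) := by
            by_contra hcon
            exact hc ⟨h3, not_lt.1 hcon⟩
          linarith
    linarith

end Coordinated

end Auction

/-! ### Measurability -/

section Measurability

variable {N : ℕ}

theorem measurable_competingBid (i : Fin N) :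
    Measurable fun p : ℝ × (Fin N → ℝ) => competingBid p.1 p.2 i := by
  unfold competingBid
  generalize Finset.univ.erase i = s
  induction s using Finset.induction_on with
  | empty => simpa using measurable_fst
  | insert a s ha ih =>
    simp only [Finset.fold_insert ha]
    exact ((measurable_pi_apply a).comp measurable_snd).max ih

theorem measurable_alloc (i : Fin N) :
    Measurable fun p : ℝ × (Fin N → ℝ) => alloc p.1 p.2 i :=
  Measurable.ite (measurableSet_le (measurable_competingBid i)
    ((measurable_pi_apply i).comp measurable_snd)) measurable_const measurable_const

theorem measurableSet_wins (i : Fin N) :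
    MeasurableSet {p : ℝ × (Fin N → ℝ) | Wins p.1 p.2 i} :=
  measurableSet_le (measurable_competingBid i) ((measurable_pi_apply i).comp measurable_snd)

/-- A scenario whose bids depend measurably on values and multipliers. -/
def MeasurableScenario (bid : Scenario N) : Prop :=
  Measurable fun p : (Fin N → ℝ) × (Fin N → ℝ) => bid p.1 p.2

theorem measurableScenario_independent : MeasurableScenario (independent (N := N)) := by
  unfold MeasurableScenario independent
  fun_prop

theorem measurableScenario_coordinated {sel : (Fin N → ℝ) → Fin N} (hsel : Measurable sel) :
    MeasurableScenario (coordinated sel) := by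
  refine measurable_pi_lambda _ fun i => ?_
  refine Measurable.ite ?_ (by fun_prop) measurable_const
  exact measurableSet_eq_fun measurable_const (hsel.comp measurable_fst)

theorem MeasurableScenario.measurable_bids {bid : Scenario N} (hbid : MeasurableScenario bid) :
    Measurable fun p : (Fin N → ℝ) × ((Fin N → ℝ) × ℝ) => (p.2.2, bid p.2.1 p.1) :=
  measurable_snd.snd.prodMk (Measurable.comp hbid (measurable_snd.fst.prodMk measurable_fst))

theorem MeasurableScenario.measurable_totalValue {bid : Scenario N}
    (hbid : MeasurableScenario bid) :
    Measurable fun p : (Fin N → ℝ) × ((Fin N → ℝ) × ℝ) =>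
      totalValue p.2.1 p.2.2 (bid p.2.1 p.1) :=
  Finset.measurable_sum _ fun i _ =>
    ((measurable_pi_apply i).comp measurable_snd.fst).mul
      ((measurable_alloc i).comp hbid.measurable_bids)

theorem MeasurableScenario.measurable_utility {bid : Scenario N}
    (hbid : MeasurableScenario bid) (i : Fin N) :
    Measurable fun p : (Fin N → ℝ) × ((Fin N → ℝ) × ℝ) =>
      utility p.2.1 p.2.2 (bid p.2.1 p.1) i :=
  (((measurable_pi_apply i).comp measurable_snd.fst).mul
    ((measurable_alloc i).comp hbid.measurable_bids)).sub
    (((measurable_alloc i).comp hbid.measurable_bids).mul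
      ((measurable_competingBid i).comp hbid.measurable_bids))

theorem MeasurableScenario.measurable_step {h : ℝ → ℝ} (hh : IsLegendreMirrorMap h) (α : ℝ)
    {bid : Scenario N} (hbid : MeasurableScenario bid) :
    Measurable fun p : (Fin N → ℝ) × ((Fin N → ℝ) × ℝ) => fun i : Fin N =>
      mirrorStep h α (utility p.2.1 p.2.2 (bid p.2.1 p.1) i) (p.1 i) := by
  refine measurable_pi_lambda _ fun i => ?_
  simp only [mirrorStep_eq_dualInv hh]
  exact (continuous_dualInv hh).measurable.comp
    (((measurable_deriv h).comp ((measurable_pi_apply i).comp measurable_fst)).sub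
      ((hbid.measurable_utility i).const_mul α))

end Measurability

/-! ### Trajectories -/

section Trajectory

variable {N : ℕ} {h : ℝ → ℝ}

theorem multipliers_pos (hh : IsLegendreMirrorMap h) (α : ℝ) (bid : Scenario N)
    (v : ℕ → Fin N → ℝ) (dO : ℕ → ℝ) (t : ℕ) (i : Fin N) : 0 < multipliers h α bid v dO t i := by
  cases t with
  | zero => exact one_pos
  | succ t => exact (mirrorStep_spec hh _ _ _).1

theorem deriv_multipliers_succ (hh : IsLegendreMirrorMap h) (α : ℝ) (bid : Scenario N)
    (v : ℕ → Fin N → ℝ) (dO : ℕ → ℝ) (t : ℕ) (i : Fin N) :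
    deriv h (multipliers h α bid v dO (t + 1) i) = deriv h (multipliers h α bid v dO t i)
      - α * utility (v t) (dO t) (bid (v t) (multipliers h α bid v dO t)) i :=
  deriv_mirrorStep hh _ _ _

/-- Bids of at most `(1 + 1/λᵢ) vᵢ` keep the utilities, computed with the outside bid as the price,
asymptotically nonnegative on average. -/
theorem neg_mul_le_sum_alloc_mul (hh : IsLegendreMirrorMap h) {B ε : ℝ} (hB : 0 < B)
    (hε : 0 < ε) {bid : Scenario N}
    (hbid : ∀ v lam, (∀ i, 0 ≤ v i) → (∀ i, 0 < lam i) →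
      ∀ i, bid v lam i ≤ (1 + 1 / lam i) * v i) :
    ∀ᶠ T : ℕ in atTop, ∀ (v : ℕ → Fin N → ℝ) (dO : ℕ → ℝ),
      (∀ t i, 0 ≤ v t i) → (∀ t i, v t i ≤ B) → (∀ t, dO t ≤ B) → ∀ i,
      -(ε * T) ≤ ∑ t ∈ Finset.range T,
        alloc (dO t) (bid (v t) (multipliers h (1 / √(T : ℝ)) bid v dO t)) i * (v t i - dO t) := by
  filter_upwards [neg_mul_le_sum_of_le hh hB hε (deriv h 1)] with T hT v dO hv hvB hdB i
  refine hT (fun t => deriv h (multipliers h (1 / √(T : ℝ)) bid v dO t i))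
    (fun t => utility (v t) (dO t) (bid (v t) (multipliers h (1 / √(T : ℝ)) bid v dO t)) i) _
    rfl (fun t => deriv_multipliers_succ hh _ _ _ _ _ _) (fun t => ?_)
    (fun t => utility_le _ _ _ _) (fun t => neg_le_alloc_mul (hv t i) hB.le (hdB t))
  have hpos := multipliers_pos hh (1 / √(T : ℝ)) bid v dO t
  rw [dualInv_deriv hh (hpos i)]
  exact neg_div_le_utility (hvB t i) (hv t i) (hpos i) (hbid _ _ (hv t) hpos i)

theorem sum_min_multipliers_mul_utility_le (hh : IsLegendreMirrorMap h) {B K η : ℝ} (hB : 0 < B)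
    (hK : 0 < K) (hη : 0 < η) (sel : (Fin N → ℝ) → Fin N) :
    ∀ᶠ T : ℕ in atTop, ∀ (v : ℕ → Fin N → ℝ) (dO : ℕ → ℝ),
      (∀ t i, 0 < v t i) → (∀ t i, v t i ≤ B) → (∀ t, 0 ≤ dO t) → (∀ t, dO t ≤ B) → ∀ i,
      ∑ t ∈ Finset.range T,
        min (multipliers h (1 / √(T : ℝ)) (coordinated sel) v dO t i) K *
          utility (v t) (dO t)
            (coordinated sel (v t) (multipliers h (1 / √(T : ℝ)) (coordinated sel) v dO t)) i
        ≤ η * T := by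
  filter_upwards [sum_min_dualInv_mul_le hh hB hK hη (deriv h 1)] with T hT v dO hv hvB hd hdB i
  have hpos := multipliers_pos hh (1 / √(T : ℝ)) (coordinated sel) v dO
  have := hT (fun t => deriv h (multipliers h (1 / √(T : ℝ)) (coordinated sel) v dO t i)) _
    rfl (fun t => deriv_multipliers_succ hh _ _ _ _ _ _)
    (fun t => abs_utility_coordinated_le (hv t) (hvB t) (hpos t) (hd t) (hdB t) i)
  simpa only [dualInv_deriv hh (hpos _ i)] using this

end Trajectory


/-! ### The law of one round -/

section Law

variable {N : ℕ} {B : ℝ} {F D : Measure ℝ}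

/-- The joint law of the values and of the outside bid of one round. -/
abbrev roundLaw (N : ℕ) (F D : Measure ℝ) : Measure ((Fin N → ℝ) × ℝ) :=
  (Measure.pi fun _ : Fin N => F).prod D

theorem pi_eq_mul_null [IsProbabilityMeasure F]
    (hF₀ : ∀ x, F {x} = 0) {i j : Fin N} (hij : i ≠ j) (c : ℝ) :
    (Measure.pi fun _ : Fin N => F) {v | v i = c * v j} = 0 := by
  have hind : IndepFun (fun v : Fin N → ℝ => v j) (fun v => v i) (Measure.pi fun _ => F) :=
    (iIndepFun_pi (μ := fun _ : Fin N => F) (X := fun _ => id)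
      fun _ => aemeasurable_id).indepFun hij.symm
  have hmap := hind.map_prod_eq_prod_map_map (measurable_pi_apply j).aemeasurable
    (measurable_pi_apply i).aemeasurable
  have hev : ∀ k, (Measure.pi fun _ : Fin N => F).map (fun v => v k) = F := fun k =>
    (measurePreserving_eval (fun _ : Fin N => F) k).map_eq
  rw [hev, hev] at hmap
  have hs : MeasurableSet {p : ℝ × ℝ | p.2 = c * p.1} :=
    measurableSet_eq_fun measurable_snd (measurable_fst.const_mul c)
  have hnull : (F.prod F) {p : ℝ × ℝ | p.2 = c * p.1} = 0 := by
    rw [Measure.measure_prod_null hs]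
    exact Eventually.of_forall fun x => hF₀ (c * x)
  rw [← hmap, Measure.map_apply (by fun_prop) hs] at hnull
  exact hnull

theorem ae_roundLaw_mul_ne_mul [IsProbabilityMeasure F]
    (hF₀ : ∀ x, F {x} = 0) {i j : Fin N} (hij : i ≠ j) {a b : ℝ}
    (ha : a ≠ 0) : ∀ᵐ z ∂(roundLaw N F D), a * z.1 i ≠ b * z.1 j := by
  refine Measure.quasiMeasurePreserving_fst.ae (p := fun v : Fin N → ℝ => a * v i ≠ b * v j) ?_
  rw [ae_iff]
  convert pi_eq_mul_null hF₀ hij (b / a) using 2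
  ext v
  simp only [ne_eq, not_not, mem_ofPred_eq]
  rw [div_mul_eq_mul_div, eq_div_iff ha, mul_comm]

theorem ae_roundLaw_mem [IsProbabilityMeasure F]
    (hF₀ : ∀ x, F {x} = 0) (hF : F.support = Icc 0 B)
    (hD : ∀ᵐ x ∂D, x ∈ Icc 0 B) :
    ∀ᵐ z ∂(roundLaw N F D), (∀ i, 0 < z.1 i ∧ z.1 i ≤ B) ∧ 0 ≤ z.2 ∧ z.2 ≤ B := by
  have hF' : ∀ᵐ x ∂F, 0 < x ∧ x ≤ B := by
    have h1 : ∀ᵐ x ∂F, x ∈ F.support := Measure.support_mem_ae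
    have h2 : ∀ᵐ x ∂F, x ≠ 0 := by
      rw [ae_iff]; simpa using hF₀ 0
    filter_upwards [h1, h2] with x hx hx0
    rw [hF] at hx
    exact ⟨lt_of_le_of_ne hx.1 hx0.symm, hx.2⟩
  have h1 : ∀ᵐ v ∂(Measure.pi fun _ : Fin N => F), ∀ i, 0 < v i ∧ v i ≤ B :=
    ae_all_iff.2 fun i => (Measure.quasiMeasurePreserving_eval (fun _ : Fin N => F) i).ae hF'
  filter_upwards [Measure.quasiMeasurePreserving_fst.ae h1,
    Measure.quasiMeasurePreserving_snd.ae hD] with z hz1 hz2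
  exact ⟨hz1, hz2⟩

theorem ae_roundLaw_injective [IsProbabilityMeasure F]
    (hF₀ : ∀ x, F {x} = 0) :
    ∀ᵐ z ∂(roundLaw N F D), Function.Injective z.1 := by
  have h1 : ∀ᵐ z ∂(roundLaw N F D), ∀ i j : Fin N, i ≠ j → z.1 i ≠ z.1 j := by
    refine ae_all_iff.2 fun i => ae_all_iff.2 fun j => ?_
    by_cases hij : i = j
    · exact Eventually.of_forall fun _ h => absurd hij h
    · filter_upwards [ae_roundLaw_mul_ne_mul (D := D) hF₀ hij (a := 1) (b := 1) one_ne_zero]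
        with z hz _
      simpa using hz
  filter_upwards [h1] with z hz i j hij
  by_contra hne
  exact hz i j hne hij

variable {sel : (Fin N → ℝ) → Fin N}

/-- The Lagrangian of bidder `i`, in the rounds where it is the chosen bidder. -/
def selLagrangian (sel : (Fin N → ℝ) → Fin N) (l : ℝ) (i : Fin N) (z : (Fin N → ℝ) × ℝ) : ℝ :=
  if sel z.1 = i then lagrangian l z.1 z.2 i else 0

theorem sum_selLagrangian (l : ℝ) (z : (Fin N → ℝ) × ℝ) :
    ∑ i, selLagrangian sel l i z = lagrangian l z.1 z.2 (sel z.1) := by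
  simp [selLagrangian]

theorem measurable_selLagrangian (hsel : Measurable sel) (i : Fin N) :
    Measurable fun p : ℝ × ((Fin N → ℝ) × ℝ) => selLagrangian sel p.1 i p.2 := by
  refine Measurable.ite ?_ ?_ measurable_const
  · exact measurableSet_eq_fun (hsel.comp measurable_snd.fst) measurable_const
  · unfold lagrangian
    fun_prop

theorem abs_selLagrangian_le {l K : ℝ} (hl : 0 ≤ l) (hlK : l ≤ K) {z : (Fin N → ℝ) × ℝ}
    (hz : (∀ i, 0 < z.1 i ∧ z.1 i ≤ B) ∧ 0 ≤ z.2 ∧ z.2 ≤ B) (i : Fin N) :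
    |selLagrangian sel l i z| ≤ B + K * B := by
  obtain ⟨hv, hd, hdB⟩ := hz
  have hB : 0 ≤ B := hd.trans hdB
  have hK : 0 ≤ K := hl.trans hlK
  unfold selLagrangian lagrangian
  split_ifs
  · rw [abs_of_nonneg (le_max_left _ _)]
    refine max_le (by positivity) ?_
    have : l * (z.1 i - z.2) ≤ K * B :=
      (mul_le_mul_of_nonneg_left (by linarith [(hv i).2]) hl).trans
        (mul_le_mul_of_nonneg_right hlK hB)
    linarith [(hv i).2]
  · rw [abs_zero]; positivity

theorem integrable_selLagrangian [IsProbabilityMeasure F] [IsProbabilityMeasure D]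
    (hF₀ : ∀ x, F {x} = 0) (hF : F.support = Icc 0 B)
    (hD : ∀ᵐ x ∂D, x ∈ Icc 0 B) (hsel : Measurable sel) {l : ℝ} (hl : 0 ≤ l) (i : Fin N) :
    Integrable (selLagrangian sel l i) (roundLaw N F D) := by
  refine Integrable.of_bound (C := B + l * B)
    ((measurable_selLagrangian hsel i).comp measurable_prodMk_left).aestronglyMeasurable ?_
  filter_upwards [ae_roundLaw_mem hF₀ hF hD] with z hz
  exact abs_selLagrangian_le hl le_rfl hz i

theorem IsArgmaxRule.apply_comp_perm (hsel : IsArgmaxRule sel) {v : Fin N → ℝ}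
    (hv : Function.Injective v) (σ : Equiv.Perm (Fin N)) : σ (sel (v ∘ σ)) = sel v := by
  refine hv (le_antisymm (hsel.le v _) ?_)
  have := hsel.le (v ∘ σ) (σ.symm (sel v))
  simpa using this

theorem integral_selLagrangian_eq [IsProbabilityMeasure F] [IsProbabilityMeasure D]
    (hF₀ : ∀ x, F {x} = 0) (hsel : IsArgmaxRule sel) (l : ℝ)
    (i j : Fin N) : ∫ z, selLagrangian sel l i z ∂(roundLaw N F D) =
      ∫ z, selLagrangian sel l j z ∂(roundLaw N F D) := by
  set σ : Equiv.Perm (Fin N) := Equiv.swap i j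
  have hσσ : ∀ k, σ (σ k) = k := fun k => Equiv.swap_apply_self i j k
  let e := MeasurableEquiv.piCongrLeft (fun _ : Fin N => ℝ) σ
  have he : ∀ v : Fin N → ℝ, e v = v ∘ σ := by
    intro v
    funext k
    have := MeasurableEquiv.piCongrLeft_apply_apply σ (β := fun _ : Fin N => ℝ) v (σ k)
    rw [hσσ] at this
    exact this
  have hmp : MeasurePreserving (e.prodCongr (MeasurableEquiv.refl ℝ))
      (roundLaw N F D) (roundLaw N F D) :=
    (measurePreserving_piCongrLeft (fun _ : Fin N => F) σ).prod (MeasurePreserving.id D)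
  rw [← hmp.integral_comp' (selLagrangian sel l j)]
  refine integral_congr_ae ?_
  filter_upwards [ae_roundLaw_injective hF₀] with z hz
  have h1 : (e.prodCongr (MeasurableEquiv.refl ℝ)) z = (z.1 ∘ σ, z.2) :=
    Prod.ext (he z.1) rfl
  have h2 : sel (z.1 ∘ σ) = j ↔ sel z.1 = i := by
    rw [← hsel.apply_comp_perm hz σ, ← Equiv.eq_symm_apply]
    simp [σ]
  rw [h1]
  simp only [selLagrangian, h2, lagrangian, Function.comp_apply, σ, Equiv.swap_apply_right]

/-- The expected Lagrangian of one round when only the chosen bidder takes part. -/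
def dualValue (sel : (Fin N → ℝ) → Fin N) (F D : Measure ℝ) (l : ℝ) : ℝ :=
  ∫ z, lagrangian l z.1 z.2 (sel z.1) ∂(roundLaw N F D)

/-- The infimum of the dual function: the asymptotic value of coordinated bidding. -/
def optValue (sel : (Fin N → ℝ) → Fin N) (F D : Measure ℝ) : ℝ :=
  sInf (dualValue sel F D '' Ioi 0)

theorem optValue_le (l : ℝ) (hl : 0 < l) : optValue sel F D ≤ dualValue sel F D l := by
  refine csInf_le ⟨0, ?_⟩ (mem_image_of_mem _ hl)
  rintro _ ⟨l, -, rfl⟩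
  exact integral_nonneg fun z => lagrangian_nonneg _ _ _ _

theorem exists_dualValue_lt {ε : ℝ} (hε : 0 < ε) :
    ∃ l > 0, dualValue sel F D l < optValue sel F D + ε := by
  obtain ⟨_, ⟨l, hl, rfl⟩, h⟩ := exists_lt_of_csInf_lt
    (Nonempty.image (dualValue sel F D) (nonempty_Ioi (a := (0 : ℝ))))
    (lt_add_of_pos_right (optValue sel F D) hε)
  exact ⟨l, hl, h⟩

theorem optValue_le_mul_integral_selLagrangian [IsProbabilityMeasure F] [IsProbabilityMeasure D]
    (hF₀ : ∀ x, F {x} = 0)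
    (hF : F.support = Icc 0 B) (hD : ∀ᵐ x ∂D, x ∈ Icc 0 B) (hsel : IsArgmaxRule sel) {l : ℝ}
    (hl : 0 < l) (i : Fin N) :
    optValue sel F D ≤ N * ∫ z, selLagrangian sel l i z ∂(roundLaw N F D) := by
  refine (optValue_le l hl).trans (le_of_eq ?_)
  simp only [dualValue, ← sum_selLagrangian]
  rw [integral_finsetSum _ fun j _ =>
    integrable_selLagrangian hF₀ hF hD hsel.measurable hl.le j]
  rw [Finset.sum_congr rfl fun j _ => integral_selLagrangian_eq hF₀ hsel l j i]
  simp

theorem measurable_apply_sel (hsel : Measurable sel) :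
    Measurable fun v : Fin N → ℝ => v (sel v) := by
  have : (fun v : Fin N → ℝ => v (sel v)) = fun v => ∑ i, if sel v = i then v i else 0 := by
    funext v; simp
  rw [this]
  exact Finset.measurable_sum _ fun i _ => Measurable.ite
    (measurableSet_eq_fun hsel measurable_const) (measurable_pi_apply i) measurable_const

theorem measurable_truncLoss (hsel : Measurable sel) (K : ℝ) :
    Measurable fun z : (Fin N → ℝ) × ℝ => truncLoss K (z.1 (sel z.1)) z.2 := by
  have hm : Measurable fun z : (Fin N → ℝ) × ℝ => z.1 (sel z.1) :=
    (measurable_apply_sel hsel).comp measurable_fst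
  refine Measurable.ite ?_ hm measurable_const
  exact (measurableSet_lt hm measurable_snd).inter
    (measurableSet_le ((measurable_snd.sub hm).const_mul K) hm)

theorem tendsto_integral_truncLoss [IsProbabilityMeasure F] [IsProbabilityMeasure D]
    (hF₀ : ∀ x, F {x} = 0) (hF : F.support = Icc 0 B)
    (hD : ∀ᵐ x ∂D, x ∈ Icc 0 B) (hsel : Measurable sel) :
    Tendsto (fun K : ℕ => ∫ z, truncLoss K (z.1 (sel z.1)) z.2 ∂(roundLaw N F D))
      atTop (𝓝 0) := by
  rw [← integral_zero ((Fin N → ℝ) × ℝ) ℝ (μ := roundLaw N F D)]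
  refine tendsto_integral_of_dominated_convergence (fun _ => B)
    (fun K => (measurable_truncLoss hsel K).aestronglyMeasurable) (integrable_const _)
    (fun K => ?_) (Eventually.of_forall fun z => ?_)
  · filter_upwards [ae_roundLaw_mem hF₀ hF hD] with z hz
    have := hz.1 (sel z.1)
    rw [Real.norm_of_nonneg (truncLoss_nonneg this.1.le)]
    exact (truncLoss_le this.1.le).trans this.2
  · refine tendsto_const_nhds.congr' ?_
    rcases lt_or_ge (z.1 (sel z.1)) z.2 with h | h
    · filter_upwards [eventually_gt_atTop ⌈z.1 (sel z.1) / (z.2 - z.1 (sel z.1))⌉₊] with K hK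
      have h1 := (Nat.le_ceil _).trans_lt (Nat.cast_lt (α := ℝ).2 hK)
      rw [div_lt_iff₀ (sub_pos.2 h)] at h1
      rw [truncLoss, if_neg fun hc => absurd hc.2 (not_le.2 h1)]
    · exact Eventually.of_forall fun K => by simp [truncLoss, not_lt.2 h]

end Law

/-! ### Independence of the multipliers and of the current round -/

section Independence

variable {N : ℕ} {F D : Measure ℝ} {h : ℝ → ℝ} {Ω : Type*}
  {v : ℕ → Ω → Fin N → ℝ} {dO : ℕ → Ω → ℝ} {bid : Scenario N}

/-- The multipliers of round `t` as a random variable. -/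
def multipliersRV (h : ℝ → ℝ) (α : ℝ) (bid : Scenario N) (v : ℕ → Ω → Fin N → ℝ)
    (dO : ℕ → Ω → ℝ) (t : ℕ) (ω : Ω) : Fin N → ℝ :=
  multipliers h α bid (fun s => v s ω) (fun s => dO s ω) t

theorem measurable_past_multipliersRV (hh : IsLegendreMirrorMap h) (α : ℝ)
    (hbid : MeasurableScenario bid) (t : ℕ) :
    Measurable[⨆ s ∈ Iio t, MeasurableSpace.comap (fun ω => (v s ω, dO s ω)) inferInstance]
      (multipliersRV h α bid v dO t) := by
  induction t with
  | zero => exact measurable_const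
  | succ t ih =>
    have h1 : Measurable[⨆ s ∈ Iio (t + 1),
        MeasurableSpace.comap (fun ω => (v s ω, dO s ω)) inferInstance]
        (multipliersRV h α bid v dO t) :=
      ih.mono (biSup_mono fun s hs => Nat.lt_succ_of_lt hs) le_rfl
    have h2 : Measurable[⨆ s ∈ Iio (t + 1),
        MeasurableSpace.comap (fun ω => (v s ω, dO s ω)) inferInstance]
        (fun ω => (v t ω, dO t ω)) :=
      (comap_measurable (fun ω => (v t ω, dO t ω))).mono
        (le_iSup₂ (f := fun s (_ : s ∈ Iio (t + 1)) =>
          MeasurableSpace.comap (fun ω => (v s ω, dO s ω)) inferInstance) t (Nat.lt_succ_self t))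
        le_rfl
    have h3 : multipliersRV h α bid v dO (t + 1) =
        (fun p : (Fin N → ℝ) × ((Fin N → ℝ) × ℝ) => fun i : Fin N =>
          mirrorStep h α (utility p.2.1 p.2.2 (bid p.2.1 p.1) i) (p.1 i)) ∘
        fun ω => (multipliersRV h α bid v dO t ω, (v t ω, dO t ω)) := rfl
    rw [h3]
    exact (hbid.measurable_step hh α).comp (h1.prodMk h2)

variable [MeasurableSpace Ω] {P : Measure Ω}

theorem measurable_multipliersRV (hh : IsLegendreMirrorMap h) (α : ℝ)
    (hbid : MeasurableScenario bid) (hv : ∀ t, Measurable (v t)) (hdO : ∀ t, Measurable (dO t))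
    (t : ℕ) : Measurable (multipliersRV h α bid v dO t) :=
  (measurable_past_multipliersRV hh α hbid t).mono
    (iSup₂_le fun s _ => ((hv s).prodMk (hdO s)).comap_le) le_rfl

theorem map_multipliersRV_prod [IsProbabilityMeasure P]
    (hh : IsLegendreMirrorMap h) (α : ℝ)
    (hbid : MeasurableScenario bid) (hv : ∀ t, Measurable (v t)) (hdO : ∀ t, Measurable (dO t))
    (hlaw : ∀ t, P.map (fun ω => (v t ω, dO t ω)) = roundLaw N F D)
    (hindep : iIndepFun (fun t ω => (v t ω, dO t ω)) P) (t : ℕ) :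
    P.map (fun ω => (multipliersRV h α bid v dO t ω, (v t ω, dO t ω))) =
      (P.map (multipliersRV h α bid v dO t)).prod (roundLaw N F D) := by
  have hind : IndepFun (multipliersRV h α bid v dO t) (fun ω => (v t ω, dO t ω)) P := by
    rw [IndepFun_iff_Indep]
    have := indep_iSup_of_disjoint (fun s => ((hv s).prodMk (hdO s)).comap_le) hindep.iIndep
      (S := Iio t) (T := {t}) (by simp)
    refine indep_of_indep_of_le_left (indep_of_indep_of_le_right this ?_)
      (measurable_past_multipliersRV hh α hbid t).comap_le
    simp
  rw [hind.map_prod_eq_prod_map_map (measurable_multipliersRV hh α hbid hv hdO t).aemeasurable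
    ((hv t).prodMk (hdO t)).aemeasurable, hlaw]

theorem ae_multipliersRV_pos (hh : IsLegendreMirrorMap h) (α : ℝ)
    (hbid : MeasurableScenario bid) (hv : ∀ t, Measurable (v t)) (hdO : ∀ t, Measurable (dO t))
    (t : ℕ) : ∀ᵐ lam ∂(P.map (multipliersRV h α bid v dO t)), ∀ i, 0 < lam i := by
  rw [ae_map_iff (measurable_multipliersRV hh α hbid hv hdO t).aemeasurable]
  · exact Eventually.of_forall fun ω i => multipliers_pos hh _ _ _ _ _ _
  · rw [ofPred_forall]
    exact MeasurableSet.iInter fun i => measurableSet_lt measurable_const (measurable_pi_apply i)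

/-- A property that holds almost surely for all fixed multipliers holds almost surely along the
trajectory. -/
theorem ae_of_forall_multipliers [IsProbabilityMeasure F] [IsProbabilityMeasure D]
    [IsProbabilityMeasure P]
    (hh : IsLegendreMirrorMap h) (α : ℝ)
    (hbid : MeasurableScenario bid) (hv : ∀ t, Measurable (v t)) (hdO : ∀ t, Measurable (dO t))
    (hlaw : ∀ t, P.map (fun ω => (v t ω, dO t ω)) = roundLaw N F D)
    (hindep : iIndepFun (fun t ω => (v t ω, dO t ω)) P) (t : ℕ)
    {p : (Fin N → ℝ) × ((Fin N → ℝ) × ℝ) → Prop} (hp : MeasurableSet {x | p x})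
    (hae : ∀ lam : Fin N → ℝ, (∀ i, 0 < lam i) → ∀ᵐ z ∂(roundLaw N F D), p (lam, z)) :
    ∀ᵐ ω ∂P, p (multipliersRV h α bid v dO t ω, (v t ω, dO t ω)) := by
  have hm : Measurable fun ω => (multipliersRV h α bid v dO t ω, (v t ω, dO t ω)) :=
    (measurable_multipliersRV hh α hbid hv hdO t).prodMk ((hv t).prodMk (hdO t))
  rw [← ae_map_iff hm.aemeasurable hp, map_multipliersRV_prod hh α hbid hv hdO hlaw hindep t]
  rw [Measure.ae_prod_iff_ae_ae hp]
  filter_upwards [ae_multipliersRV_pos hh α hbid hv hdO t] with lam hlam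
  exact hae lam hlam

theorem le_integral_of_forall_multipliers [IsProbabilityMeasure F] [IsProbabilityMeasure D]
    [IsProbabilityMeasure P]
    (hh : IsLegendreMirrorMap h) (α : ℝ)
    (hbid : MeasurableScenario bid) (hv : ∀ t, Measurable (v t)) (hdO : ∀ t, Measurable (dO t))
    (hlaw : ∀ t, P.map (fun ω => (v t ω, dO t ω)) = roundLaw N F D)
    (hindep : iIndepFun (fun t ω => (v t ω, dO t ω)) P) (t : ℕ)
    {f : (Fin N → ℝ) × ((Fin N → ℝ) × ℝ) → ℝ} (hf : Measurable f)
    (hint : Integrable (fun ω => f (multipliersRV h α bid v dO t ω, (v t ω, dO t ω))) P) {c : ℝ}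
    (hc : ∀ lam : Fin N → ℝ, (∀ i, 0 < lam i) → c ≤ ∫ z, f (lam, z) ∂(roundLaw N F D)) :
    c ≤ ∫ ω, f (multipliersRV h α bid v dO t ω, (v t ω, dO t ω)) ∂P := by
  have hm : Measurable fun ω => (multipliersRV h α bid v dO t ω, (v t ω, dO t ω)) :=
    (measurable_multipliersRV hh α hbid hv hdO t).prodMk ((hv t).prodMk (hdO t))
  have hΛ := measurable_multipliersRV hh α hbid hv hdO t
  have : IsProbabilityMeasure (P.map (multipliersRV h α bid v dO t)) :=
    Measure.isProbabilityMeasure_map hΛ.aemeasurable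
  have hint' : Integrable f ((P.map (multipliersRV h α bid v dO t)).prod (roundLaw N F D)) := by
    rw [← map_multipliersRV_prod hh α hbid hv hdO hlaw hindep t]
    exact (integrable_map_measure hf.aestronglyMeasurable hm.aemeasurable).2 hint
  have hmap := integral_map hm.aemeasurable (μ := P) (f := f) hf.aestronglyMeasurable
  rw [← hmap, map_multipliersRV_prod hh α hbid hv hdO hlaw hindep t, integral_prod _ hint']
  calc c = ∫ _, c ∂(P.map (multipliersRV h α bid v dO t)) := by simp
    _ ≤ _ := by
      refine integral_mono_ae (integrable_const _) hint'.integral_prod_left ?_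
      filter_upwards [ae_multipliersRV_pos hh α hbid hv hdO t] with lam hlam
      exact hc lam hlam

end Independence


/-! ### Asymptotic values -/

section Asymptotics

variable {N : ℕ} {B : ℝ} {F D : Measure ℝ} [IsProbabilityMeasure F]
  {h : ℝ → ℝ} {Ω : Type*} [MeasurableSpace Ω] {P : Measure Ω}
  {v : ℕ → Ω → Fin N → ℝ} {dO : ℕ → Ω → ℝ} {bid : Scenario N} {sel : (Fin N → ℝ) → Fin N}

/-- In almost every realization all values are in `(0, B]` and all outside bids in `[0, B]`. -/
theorem ae_forall_mem (hF₀ : ∀ x, F {x} = 0) (hF : F.support = Icc 0 B)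
    (hD : ∀ᵐ x ∂D, x ∈ Icc 0 B)
    (hv : ∀ t, Measurable (v t)) (hdO : ∀ t, Measurable (dO t))
    (hlaw : ∀ t, P.map (fun ω => (v t ω, dO t ω)) = roundLaw N F D) :
    ∀ᵐ ω ∂P, ∀ t, (∀ i, 0 < v t ω i ∧ v t ω i ≤ B) ∧ 0 ≤ dO t ω ∧ dO t ω ≤ B := by
  refine ae_all_iff.2 fun t => ?_
  have := ae_roundLaw_mem (N := N) hF₀ hF hD
  rw [← hlaw t] at this
  exact ae_of_ae_map ((hv t).prodMk (hdO t)).aemeasurable this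

theorem ae_independent_not_wins (hF₀ : ∀ x, F {x} = 0) (lam : Fin N → ℝ)
    (hlam : ∀ i, 0 < lam i) : ∀ᵐ z ∂(roundLaw N F D), ∀ i j, i ≠ j →
      ¬ (Wins z.2 (independent z.1 lam) i ∧ Wins z.2 (independent z.1 lam) j) := by
  refine ae_all_iff.2 fun i => ae_all_iff.2 fun j => ?_
  by_cases hij : i = j
  · exact Eventually.of_forall fun _ h => absurd hij h
  have ha : 1 + 1 / lam i ≠ 0 := by have := hlam i; positivity
  filter_upwards [ae_roundLaw_mul_ne_mul (D := D) hF₀ hij (b := 1 + 1 / lam j) ha] with z hz _ hw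
  exact hz (independent_eq_of_wins hij hw.1 hw.2)

theorem ae_coordinated_not_wins (hF₀ : ∀ x, F {x} = 0) (hF : F.support = Icc 0 B)
    (hD : ∀ᵐ x ∂D, x ∈ Icc 0 B) (lam : Fin N → ℝ) (hlam : ∀ i, 0 < lam i) :
    ∀ᵐ z ∂(roundLaw N F D), ∀ i j, i ≠ j →
      ¬ (Wins z.2 (coordinated sel z.1 lam) i ∧ Wins z.2 (coordinated sel z.1 lam) j) := by
  filter_upwards [ae_roundLaw_mem hF₀ hF hD] with z hz i j hij hw
  have hpos : ∀ i, 0 < z.1 i := fun i => (hz.1 i).1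
  exact hij (((coordinated_wins_iff hpos hlam).1 hw.1).1.trans
    ((coordinated_wins_iff hpos hlam).1 hw.2).1.symm)

theorem coordinated_le {v lam : Fin N → ℝ} (hv : ∀ i, 0 ≤ v i) (hlam : ∀ i, 0 < lam i)
    (i : Fin N) : coordinated sel v lam i ≤ (1 + 1 / lam i) * v i := by
  unfold coordinated
  split_ifs
  · exact le_rfl
  · have := hv i; have := hlam i; positivity

variable [IsProbabilityMeasure P]

theorem integrable_avgValueRV (hF₀ : ∀ x, F {x} = 0) (hF : F.support = Icc 0 B)
    (hD : ∀ᵐ x ∂D, x ∈ Icc 0 B) (hh : IsLegendreMirrorMap h) (hbid : MeasurableScenario bid)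
    (hv : ∀ t, Measurable (v t)) (hdO : ∀ t, Measurable (dO t))
    (hlaw : ∀ t, P.map (fun ω => (v t ω, dO t ω)) = roundLaw N F D) (T : ℕ) :
    Integrable (avgValueRV h bid v dO T) P := by
  refine Integrable.const_mul (integrable_finsetSum _ fun t _ => ?_) _
  have hm : Measurable fun ω => totalValue (v t ω) (dO t ω)
      (bid (v t ω) (multipliersRV h (1 / √(T : ℝ)) bid v dO t ω)) :=
    hbid.measurable_totalValue.comp
      ((measurable_multipliersRV hh _ hbid hv hdO t).prodMk ((hv t).prodMk (hdO t)))
  refine Integrable.of_bound (C := N * B) hm.aestronglyMeasurable ?_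
  filter_upwards [ae_forall_mem hF₀ hF hD hv hdO hlaw] with ω hω
  have h0 : ∀ i, 0 ≤ v t ω i := fun i => ((hω t).1 i).1.le
  rw [Real.norm_of_nonneg (totalValue_nonneg h0)]
  exact totalValue_le h0 fun i => ((hω t).1 i).2

variable [IsProbabilityMeasure D]

/-- No scenario with at most one winner and bids of at most `(1 + 1/λᵢ) vᵢ` asymptotically achieves
more than the optimal value. -/
theorem eventually_integral_avgValueRV_le (hB : 0 < B) (hF₀ : ∀ x, F {x} = 0)
    (hF : F.support = Icc 0 B) (hD : ∀ᵐ x ∂D, x ∈ Icc 0 B) (hh : IsLegendreMirrorMap h)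
    (hsel : IsArgmaxRule sel) (hbid : MeasurableScenario bid)
    (hle : ∀ v lam, (∀ i, 0 ≤ v i) → (∀ i, 0 < lam i) →
      ∀ i, bid v lam i ≤ (1 + 1 / lam i) * v i)
    (hone : ∀ lam : Fin N → ℝ, (∀ i, 0 < lam i) → ∀ᵐ z ∂(roundLaw N F D), ∀ i j, i ≠ j →
      ¬ (Wins z.2 (bid z.1 lam) i ∧ Wins z.2 (bid z.1 lam) j))
    (hv : ∀ t, Measurable (v t)) (hdO : ∀ t, Measurable (dO t))
    (hlaw : ∀ t, P.map (fun ω => (v t ω, dO t ω)) = roundLaw N F D)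
    (hindep : iIndepFun (fun t ω => (v t ω, dO t ω)) P) {ε : ℝ} (hε : 0 < ε) :
    ∀ᶠ T : ℕ in atTop, ∫ ω, avgValueRV h bid v dO T ω ∂P ≤ optValue sel F D + ε := by
  obtain ⟨l, hl, hlε⟩ := exists_dualValue_lt (sel := sel) (F := F) (D := D) (half_pos hε)
  have hN : (0 : ℝ) < N := by exact_mod_cast Fin.pos (sel 0)
  have hε' : 0 < ε / (2 * N * l) := by positivity
  filter_upwards [neg_mul_le_sum_alloc_mul hh hB hε' hle, eventually_gt_atTop 0] with T hT hT0
  have hTpos : (0 : ℝ) < T := by exact_mod_cast hT0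
  have hwin : ∀ᵐ ω ∂P, ∀ t, ∀ i j, i ≠ j →
      ¬ (Wins (dO t ω) (bid (v t ω) (multipliersRV h (1 / √(T : ℝ)) bid v dO t ω)) i ∧
        Wins (dO t ω) (bid (v t ω) (multipliersRV h (1 / √(T : ℝ)) bid v dO t ω)) j) := by
    refine ae_all_iff.2 fun t => ?_
    refine ae_of_forall_multipliers hh _ hbid hv hdO hlaw hindep t
      (p := fun x => ∀ i j, i ≠ j →
        ¬ (Wins x.2.2 (bid x.2.1 x.1) i ∧ Wins x.2.2 (bid x.2.1 x.1) j)) ?_ hone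
    simp only [ofPred_forall]
    refine MeasurableSet.iInter fun i => MeasurableSet.iInter fun j => MeasurableSet.iInter fun _ =>
      MeasurableSet.compl (MeasurableSet.inter ?_ ?_)
    · exact hbid.measurable_bids (measurableSet_wins i)
    · exact hbid.measurable_bids (measurableSet_wins j)
  have hlagm : Measurable fun z : (Fin N → ℝ) × ℝ => lagrangian l z.1 z.2 (sel z.1) := by
    simp only [← sum_selLagrangian]
    exact Finset.measurable_sum _ fun i _ =>
      (measurable_selLagrangian hsel.measurable i).comp measurable_prodMk_left
  have hlagi : Integrable (fun z : (Fin N → ℝ) × ℝ => lagrangian l z.1 z.2 (sel z.1))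
      (roundLaw N F D) := by
    simp only [← sum_selLagrangian]
    exact integrable_finsetSum _ fun i _ =>
      integrable_selLagrangian hF₀ hF hD hsel.measurable hl.le i
  have hZ : ∀ t, Measurable fun ω => (v t ω, dO t ω) := fun t => (hv t).prodMk (hdO t)
  have hint : ∀ t, Integrable (fun ω => lagrangian l (v t ω) (dO t ω) (sel (v t ω))) P := by
    intro t
    rw [← hlaw t] at hlagi
    exact (integrable_map_measure hlagm.aestronglyMeasurable (hZ t).aemeasurable).1 hlagi
  have hval : ∀ t, ∫ ω, lagrangian l (v t ω) (dO t ω) (sel (v t ω)) ∂P = dualValue sel F D l := by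
    intro t
    rw [dualValue, ← hlaw t, integral_map (hZ t).aemeasurable hlagm.aestronglyMeasurable]
  have hpt : ∀ᵐ ω ∂P, avgValueRV h bid v dO T ω ≤
      1 / (T : ℝ) * ∑ t ∈ Finset.range T, lagrangian l (v t ω) (dO t ω) (sel (v t ω)) + ε / 2 := by
    filter_upwards [ae_forall_mem hF₀ hF hD hv hdO hlaw, hwin] with ω hω hwω
    have h1 := hT (fun t => v t ω) (fun t => dO t ω) (fun t i => ((hω t).1 i).1.le)
      (fun t i => ((hω t).1 i).2) fun t => (hω t).2.2
    have h2 : ∑ t ∈ Finset.range T, totalValue (v t ω) (dO t ω)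
          (bid (v t ω) (multipliersRV h (1 / √(T : ℝ)) bid v dO t ω)) +
        l * ∑ i, ∑ t ∈ Finset.range T, alloc (dO t ω)
          (bid (v t ω) (multipliersRV h (1 / √(T : ℝ)) bid v dO t ω)) i * (v t ω i - dO t ω) ≤
        ∑ t ∈ Finset.range T, lagrangian l (v t ω) (dO t ω) (sel (v t ω)) := by
      rw [Finset.sum_comm, Finset.mul_sum, ← Finset.sum_add_distrib]
      exact Finset.sum_le_sum fun t _ => totalValue_add_le hl.le (hsel.le _) (hwω t)
    have h3 : -(N * (ε / (2 * N * l) * T)) ≤ ∑ i, ∑ t ∈ Finset.range T, alloc (dO t ω)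
          (bid (v t ω) (multipliersRV h (1 / √(T : ℝ)) bid v dO t ω)) i * (v t ω i - dO t ω) := by
      refine le_trans (le_of_eq ?_) (Finset.sum_le_sum fun i _ => h1 i)
      simp
    have h4 := mul_le_mul_of_nonneg_left h3 hl.le
    have h5 : l * -(N * (ε / (2 * N * l) * T)) = -(ε / 2 * T) := by field_simp
    have h6 : ∑ t ∈ Finset.range T, totalValue (v t ω) (dO t ω)
          (bid (v t ω) (multipliersRV h (1 / √(T : ℝ)) bid v dO t ω)) ≤
        ∑ t ∈ Finset.range T, lagrangian l (v t ω) (dO t ω) (sel (v t ω)) + ε / 2 * T := by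
      linarith
    have h7 := mul_le_mul_of_nonneg_left h6 (one_div_pos.2 hTpos).le
    have h8 : 1 / (T : ℝ) * (ε / 2 * T) = ε / 2 := by field_simp
    rw [mul_add, h8] at h7
    exact h7
  have hsumi : Integrable (fun ω => 1 / (T : ℝ) *
      ∑ t ∈ Finset.range T, lagrangian l (v t ω) (dO t ω) (sel (v t ω))) P :=
    (integrable_finsetSum _ fun t _ => hint t).const_mul _
  have hmain := integral_mono_ae (integrable_avgValueRV hF₀ hF hD hh hbid hv hdO hlaw T)
    (hsumi.add (integrable_const (ε / 2))) hpt
  have hcalc : ∫ ω, (1 / (T : ℝ) *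
      ∑ t ∈ Finset.range T, lagrangian l (v t ω) (dO t ω) (sel (v t ω)) + ε / 2) ∂P =
      dualValue sel F D l + ε / 2 := by
    rw [integral_add hsumi (integrable_const _), integral_const_mul,
      integral_finsetSum _ fun t _ => hint t]
    simp only [hval, Finset.sum_const, Finset.card_range, integral_const, nsmul_eq_mul]
    simp only [probReal_univ, one_smul]
    field_simp
  have : ∫ ω, avgValueRV h bid v dO T ω ∂P ≤ dualValue sel F D l + ε / 2 := hcalc ▸ hmain
  linarith

theorem le_sum_totalValue_coordinated (hh : IsLegendreMirrorMap h) {K η : ℝ} (hB : 0 < B)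
    (hK : 0 < K) (hη : 0 < η) (sel : (Fin N → ℝ) → Fin N) :
    ∀ᶠ T : ℕ in atTop, ∀ (v : ℕ → Fin N → ℝ) (dO : ℕ → ℝ),
      (∀ t, (∀ i, 0 < v t i ∧ v t i ≤ B) ∧ 0 ≤ dO t ∧ dO t ≤ B) →
      ∑ t ∈ Finset.range T, (∑ i, selLagrangian sel
          (min (multipliers h (1 / √(T : ℝ)) (coordinated sel) v dO t i) K) i (v t, dO t)
          - truncLoss K (v t (sel (v t))) (dO t)) - N * η * T ≤
        ∑ t ∈ Finset.range T, totalValue (v t) (dO t)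
          (coordinated sel (v t) (multipliers h (1 / √(T : ℝ)) (coordinated sel) v dO t)) := by
  filter_upwards [sum_min_multipliers_mul_utility_le hh hB hK hη sel] with T hT v dO hvd
  set lam := multipliers h (1 / √(T : ℝ)) (coordinated sel) v dO
  have hpos : ∀ t i, 0 < lam t i := multipliers_pos hh _ _ _ _
  have h1 := hT v dO (fun t i => ((hvd t).1 i).1) (fun t i => ((hvd t).1 i).2)
    (fun t => (hvd t).2.1) (fun t => (hvd t).2.2)
  have h2 : ∑ t ∈ Finset.range T, ∑ i, min (lam t i) K *
      utility (v t) (dO t) (coordinated sel (v t) (lam t)) i ≤ N * η * T := by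
    rw [Finset.sum_comm]
    refine (Finset.sum_le_sum fun i _ => h1 i).trans (le_of_eq ?_)
    simp [mul_assoc]
  have h3 : ∑ t ∈ Finset.range T, (∑ i, selLagrangian sel (min (lam t i) K) i (v t, dO t)
      - truncLoss K (v t (sel (v t))) (dO t)) - ∑ t ∈ Finset.range T, ∑ i, min (lam t i) K *
      utility (v t) (dO t) (coordinated sel (v t) (lam t)) i ≤ ∑ t ∈ Finset.range T,
        totalValue (v t) (dO t) (coordinated sel (v t) (lam t)) := by
    rw [← Finset.sum_sub_distrib]
    refine Finset.sum_le_sum fun t _ => ?_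
    have e : truncLoss K (v t (sel (v t))) (dO t) =
        ∑ i, if sel (v t) = i then truncLoss K (v t i) (dO t) else 0 := by simp
    rw [e, ← Finset.sum_sub_distrib, ← Finset.sum_sub_distrib]
    exact Finset.sum_le_sum fun i _ => lagrangian_le_value_coordinated
      (fun i => ((hvd t).1 i).1) (hpos t) (hvd t).2.1 hK i
  linarith

/-- Coordinated bidding asymptotically achieves the optimal value. -/
theorem eventually_le_integral_avgValueRV_coordinated (hB : 0 < B) (hF₀ : ∀ x, F {x} = 0)
    (hF : F.support = Icc 0 B) (hD : ∀ᵐ x ∂D, x ∈ Icc 0 B) (hh : IsLegendreMirrorMap h)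
    (hsel : IsArgmaxRule sel)
    (hv : ∀ t, Measurable (v t)) (hdO : ∀ t, Measurable (dO t))
    (hlaw : ∀ t, P.map (fun ω => (v t ω, dO t ω)) = roundLaw N F D)
    (hindep : iIndepFun (fun t ω => (v t ω, dO t ω)) P) {ε : ℝ} (hε : 0 < ε) :
    ∀ᶠ T : ℕ in atTop,
      optValue sel F D - ε ≤ ∫ ω, avgValueRV h (coordinated sel) v dO T ω ∂P := by
  have hbid := measurableScenario_coordinated hsel.measurable
  have hN : (0 : ℝ) < N := by exact_mod_cast Fin.pos (sel 0)
  obtain ⟨K, hKε, hK0⟩ := (((tendsto_integral_truncLoss (N := N) hF₀ hF hD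
    hsel.measurable).eventually_lt_const (half_pos hε)).and (eventually_gt_atTop 0)).exists
  have hK : (0 : ℝ) < K := by exact_mod_cast hK0
  have hη : 0 < ε / (2 * N) := by positivity
  filter_upwards [le_sum_totalValue_coordinated hh hB hK hη sel, eventually_gt_atTop 0]
    with T hT hT0
  have hTpos : (0 : ℝ) < T := by exact_mod_cast hT0
  set Λ := multipliersRV h (1 / √(T : ℝ)) (coordinated sel) v dO
  have hΛm : ∀ t, Measurable (Λ t) := measurable_multipliersRV hh _ hbid hv hdO
  have hZ : ∀ t, Measurable fun ω => (v t ω, dO t ω) := fun t => (hv t).prodMk (hdO t)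
  have hgood := ae_forall_mem hF₀ hF hD hv hdO hlaw
  have hfm : ∀ i, Measurable fun x : (Fin N → ℝ) × ((Fin N → ℝ) × ℝ) =>
      selLagrangian sel (min (x.1 i) K) i x.2 := by
    intro i
    have hg : Measurable fun x : (Fin N → ℝ) × ((Fin N → ℝ) × ℝ) => (min (x.1 i) (K : ℝ), x.2) := by
      fun_prop
    exact (measurable_selLagrangian hsel.measurable i).comp hg
  have hlagi : ∀ t i, Integrable
      (fun ω => selLagrangian sel (min (Λ t ω i) K) i (v t ω, dO t ω)) P := by
    intro t i
    refine Integrable.of_bound (C := B + K * B)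
      ((hfm i).comp ((hΛm t).prodMk (hZ t))).aestronglyMeasurable ?_
    filter_upwards [hgood] with ω hω
    exact abs_selLagrangian_le (le_min (multipliers_pos hh _ _ _ _ _ _).le hK.le)
      (min_le_right _ _) (hω t) i
  have hlag : ∀ t i, optValue sel F D / N ≤
      ∫ ω, selLagrangian sel (min (Λ t ω i) K) i (v t ω, dO t ω) ∂P := by
    intro t i
    refine le_integral_of_forall_multipliers hh _ hbid hv hdO hlaw hindep t (hfm i) (hlagi t i)
      fun lam hlam => ?_
    rw [div_le_iff₀' hN]
    exact optValue_le_mul_integral_selLagrangian hF₀ hF hD hsel (lt_min (hlam i) hK) i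
  have hloss_m := measurable_truncLoss hsel.measurable (K : ℝ)
  have hlossi : ∀ t, Integrable (fun ω => truncLoss K (v t ω (sel (v t ω))) (dO t ω)) P := by
    intro t
    refine Integrable.of_bound (C := B) (hloss_m.comp (hZ t)).aestronglyMeasurable ?_
    filter_upwards [hgood] with ω hω
    have := (hω t).1 (sel (v t ω))
    rw [Real.norm_of_nonneg (truncLoss_nonneg this.1.le)]
    exact (truncLoss_le this.1.le).trans this.2
  have hloss : ∀ t, ∫ ω, truncLoss K (v t ω (sel (v t ω))) (dO t ω) ∂P < ε / 2 := by
    intro t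
    rwa [← hlaw t, integral_map (hZ t).aemeasurable hloss_m.aestronglyMeasurable] at hKε
  set X : ℕ → Ω → ℝ := fun t ω =>
    ∑ i, selLagrangian sel (min (Λ t ω i) K) i (v t ω, dO t ω)
      - truncLoss K (v t ω (sel (v t ω))) (dO t ω) with hX
  have hXi : ∀ t, Integrable (X t) P := fun t =>
    (integrable_finsetSum _ fun i _ => hlagi t i).sub (hlossi t)
  have hXle : ∀ t, optValue sel F D - ε / 2 ≤ ∫ ω, X t ω ∂P := by
    intro t
    rw [hX, integral_sub (integrable_finsetSum _ fun i _ => hlagi t i) (hlossi t),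
      integral_finsetSum _ fun i _ => hlagi t i]
    have h1 : optValue sel F D ≤
        ∑ i, ∫ ω, selLagrangian sel (min (Λ t ω i) K) i (v t ω, dO t ω) ∂P := by
      refine le_trans (le_of_eq ?_) (Finset.sum_le_sum fun i _ => hlag t i)
      simp only [Finset.sum_const, Finset.card_univ, Fintype.card_fin, nsmul_eq_mul]
      field_simp
    linarith [hloss t]
  have hpt : ∀ᵐ ω ∂P, 1 / (T : ℝ) * ∑ t ∈ Finset.range T, X t ω - ε / 2 ≤
      avgValueRV h (coordinated sel) v dO T ω := by
    filter_upwards [hgood] with ω hω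
    have h1 := mul_le_mul_of_nonneg_left (hT (fun t => v t ω) (fun t => dO t ω) hω)
      (one_div_pos.2 hTpos).le
    rw [mul_sub, show 1 / (T : ℝ) * (N * (ε / (2 * N)) * T) = ε / 2 by field_simp] at h1
    exact h1
  have hsumi : Integrable (fun ω => 1 / (T : ℝ) * ∑ t ∈ Finset.range T, X t ω) P :=
    (integrable_finsetSum _ fun t _ => hXi t).const_mul _
  have hmain := integral_mono_ae (hsumi.sub (integrable_const (ε / 2)))
    (integrable_avgValueRV hF₀ hF hD hh hbid hv hdO hlaw T) hpt
  refine le_trans ?_ hmain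
  change _ ≤ ∫ ω, (1 / (T : ℝ) * ∑ t ∈ Finset.range T, X t ω - ε / 2) ∂P
  rw [integral_sub hsumi (integrable_const _), integral_const_mul,
    integral_finsetSum _ fun t _ => hXi t]
  have h1 : T * (optValue sel F D - ε / 2) ≤ ∑ t ∈ Finset.range T, ∫ ω, X t ω ∂P := by
    refine le_trans (le_of_eq ?_) (Finset.sum_le_sum fun t _ => hXle t)
    simp only [Finset.sum_const, Finset.card_range, nsmul_eq_mul]
  have h2 := mul_le_mul_of_nonneg_left h1 (one_div_pos.2 hTpos).le
  rw [show 1 / (T : ℝ) * (T * (optValue sel F D - ε / 2)) = optValue sel F D - ε / 2 by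
    field_simp] at h2
  simp only [integral_const, probReal_univ, one_smul]
  linarith

end Asymptotics

end AutoBid

end

theorem theorem2 {N : ℕ} {B : ℝ} (hB : 0 < B)
    (F D : Measure ℝ) [IsProbabilityMeasure F] [IsProbabilityMeasure D]
    (hF₀ : ∀ x, F {x} = 0) (hF : F.support = Set.Icc 0 B) (hD : ∀ᵐ x ∂D, x ∈ Set.Icc 0 B)
    {h : ℝ → ℝ} (hh : AutoBid.IsLegendreMirrorMap h)
    {sel : (Fin N → ℝ) → Fin N} (hsel : AutoBid.IsArgmaxRule sel)
    {Ω : Type*} [MeasurableSpace Ω] (P : Measure Ω) [IsProbabilityMeasure P]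
    (v : ℕ → Ω → Fin N → ℝ) (dO : ℕ → Ω → ℝ)
    (hv : ∀ t, Measurable (v t)) (hdO : ∀ t, Measurable (dO t))
    (hlaw : ∀ t, P.map (fun ω => (v t ω, dO t ω)) = (Measure.pi fun _ : Fin N => F).prod D)
    (hindep : iIndepFun (fun t ω => (v t ω, dO t ω)) P) :
    (∀ T, Integrable (AutoBid.avgValueRV h (AutoBid.coordinated sel) v dO T) P ∧
      Integrable (AutoBid.avgValueRV h AutoBid.independent v dO T) P) ∧
    (∃ L : ℝ,
      Tendsto (fun T => ∫ ω, AutoBid.avgValueRV h (AutoBid.coordinated sel) v dO T ω ∂P)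
        atTop (𝓝 L) ∧
      limsup (fun T => ((∫ ω, AutoBid.avgValueRV h AutoBid.independent v dO T ω ∂P : ℝ) : EReal))
        atTop ≤ (L : EReal)) ∧
    0 ≤ liminf (fun T => ((∫ ω, (AutoBid.avgValueRV h (AutoBid.coordinated sel) v dO T ω
        - AutoBid.avgValueRV h AutoBid.independent v dO T ω) ∂P : ℝ) : EReal)) atTop := by
  have hmC := AutoBid.measurableScenario_coordinated hsel.measurable
  have hmI := AutoBid.measurableScenario_independent (N := N)
  have hiC := AutoBid.integrable_avgValueRV hF₀ hF hD hh hmC hv hdO hlaw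
  have hiI := AutoBid.integrable_avgValueRV hF₀ hF hD hh hmI hv hdO hlaw
  have hlowC : ∀ ε > 0, ∀ᶠ T : ℕ in atTop, AutoBid.optValue sel F D - ε ≤
      ∫ ω, AutoBid.avgValueRV h (AutoBid.coordinated sel) v dO T ω ∂P := fun ε hε =>
    AutoBid.eventually_le_integral_avgValueRV_coordinated hB hF₀ hF hD hh hsel hv hdO hlaw hindep hε
  have hupC : ∀ ε > 0, ∀ᶠ T : ℕ in atTop,
      ∫ ω, AutoBid.avgValueRV h (AutoBid.coordinated sel) v dO T ω ∂P ≤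
        AutoBid.optValue sel F D + ε := fun ε hε =>
    AutoBid.eventually_integral_avgValueRV_le hB hF₀ hF hD hh hsel hmC
      (fun v lam hv hlam i => AutoBid.coordinated_le hv hlam i)
      (AutoBid.ae_coordinated_not_wins hF₀ hF hD) hv hdO hlaw hindep hε
  have hupI : ∀ ε > 0, ∀ᶠ T : ℕ in atTop,
      ∫ ω, AutoBid.avgValueRV h AutoBid.independent v dO T ω ∂P ≤
        AutoBid.optValue sel F D + ε := fun ε hε =>
    AutoBid.eventually_integral_avgValueRV_le hB hF₀ hF hD hh hsel hmI
      (fun v lam hv hlam i => le_rfl)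
      (AutoBid.ae_independent_not_wins hF₀) hv hdO hlaw hindep hε
  refine ⟨fun T => ⟨hiC T, hiI T⟩, ⟨AutoBid.optValue sel F D, ?_, ?_⟩, ?_⟩
  · rw [Metric.tendsto_atTop']
    intro ε hε
    obtain ⟨n, hn⟩ := eventually_atTop.1 ((hlowC _ (half_pos hε)).and (hupC _ (half_pos hε)))
    refine ⟨n, fun T hT => ?_⟩
    obtain ⟨h1, h2⟩ := hn T hT.le
    rw [Real.dist_eq, abs_lt]
    constructor <;> linarith
  · refine EReal.le_of_forall_lt_iff_le.1 fun z hz => ?_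
    have hz' : AutoBid.optValue sel F D < z := by exact_mod_cast hz
    refine limsup_le_of_le (by isBoundedDefault) ?_
    filter_upwards [hupI _ (sub_pos.2 hz')] with T hT
    exact_mod_cast hT.trans (by linarith)
  · refine EReal.ge_of_forall_gt_iff_ge.1 fun z hz => ?_
    have hz' : z < 0 := by exact_mod_cast hz
    refine le_liminf_of_le (by isBoundedDefault) ?_
    filter_upwards [hlowC (-z / 2) (by linarith), hupI (-z / 2) (by linarith)] with T h1 h2
    rw [integral_sub (hiC T) (hiI T)]
    exact_mod_cast (by linarith : z ≤ _)
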